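/- Let $n,k\in\mathbb N$ ($k=0$ allowed) and let $0<\sigma_1<\sigma/2<\sigma_2\le\sigma$, $n>4\sigma_1$, $s\ge 0$. Consider the Cauchy problem $$u_{tt}+(-\Delta)^{\sigma}u+(-\Delta)^{\sigma_1}u_t+(-\Delta)^{\sigma_2}u_t=0\quad(x\in\mathbb R^n,\ t>0),\qquad u(0,\cdot)=u_0,\quad u_t(0,\cdot)=u_1,$$ where $(-\Delta)^\theta$ is the Fourier multiplier with symbol $|\xi|^{2\theta}$, $\widehat f(\xi)=\int e^{-ix\cdot\xi}f(x)\,dx$, and a solution is understood as an $L^2$-valued function $u(t)$, $t\ge0$, whose Fourier transform $\widehat u(t,\xi)$ solves, for almost every $\xi$, the ordinary differential equation in $t$ obtained from the problem by Fourier transform, with initial values $\widehat u_0(\xi)$, $\widehat u_1(\xi)$. The data are taken in $$\mathcal D_s=(H^s\cap L^1)\times(H^{[s-2\sigma_2]^+}\cap L^1),\qquad [\nu]^+=\max\{\nu,0\},$$ with $\|(u_0,u_1)\|_{\mathcal D_s}=\|u_0\|_{L^1}+\|u_0\|_{H^s}+\|u_1\|_{L^1}+\|u_1\|_{H^{[s-2\sigma_2]^+}}$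 and $\|f\|_{H^\nu}=\|(1+|\xi|^2)^{\nu/2}\widehat f\,\|_{L^2}$. For $r>0$ and real $a,b$ put $$\Gamma_1=\frac1{1+a r^{2(\sigma_2-\sigma_1)}},\quad \Gamma_2=\big(1-4b\,r^{2(\sigma-2\sigma_1)}\Gamma_1^2\big)^{1/2},\quad G=\big((r^{2\sigma_1}+a r^{2\sigma_2})^2-4b\,r^{2\sigma}\big)^{1/2},$$ $$\lambda_1^0=\frac{-2r^{2(\sigma-\sigma_1)}\Gamma_1}{1+\Gamma_2},\qquad \lambda_2^0=-\tfrac12\big(r^{2\sigma_1}+a r^{2\sigma_2}+G\big),$$ $$K_0^1=\frac{\lambda_1^0e^{\lambda_2^0t}}{G},\qquad K_0^2=\frac{\lambda_2^0e^{\lambda_1^0t}}{G},\qquad K_1^1=\frac{e^{\lambda_1^0t}}{G},\qquad K_1^2=\frac{e^{\lambda_2^0t}}{G}$$ (these are smooth in $(a,b)$ near $(0,0)$ for each $r>0$), and for $i\in\{0,1\}$ $$\mathcal A_i^k(t,\xi)=\sum_{0\le j+m\le k-1}\frac1{j!\,m!}\,\frac{\partial^{j+m}(K_i^1-K_i^2)}{\partial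 a^j\,\partial b^m}\Big|_{(a,b)=(0,0),\ r=|\xi|},\qquad \mathcal A_i^0=0.$$ Let $\delta=\min\{\sigma_2-\sigma_1,\ \sigma-2\sigma_1\}$ and $$\rho=-\frac{n}{4(\sigma-\sigma_1)}-\frac{s}{2(\sigma-\sigma_1)}+\frac{\sigma_1}{\sigma-\sigma_1}-\frac{k\delta}{\sigma-\sigma_1},$$ $$E(t)=\big\||\xi|^s\widehat u(t,\xi)-|\xi|^s\mathcal A_0^k(t,\xi)\widehat u_0(\xi)-|\xi|^s\mathcal A_1^k(t,\xi)\widehat u_1(\xi)\big\|_{L^2}.$$ (i) There is a constant $C>0$ depending only on $n,k,\sigma,\sigma_1,\sigma_2,s$ such that for all $(u_0,u_1)\in\mathcal D_s$ the solution satisfies $$E(t)\le C(1+t)^{\rho}\,\|(u_0,u_1)\|_{\mathcal D_s}\qquad\text{for all }t\ge1.$$ (ii) There is a constant $c>0$ depending only on $n,k,\sigma,\sigma_1,\sigma_2,s$ such that for all $(u_0,u_1)\in\mathcal D_s$ with $P_1=\int_{\mathbb R^n}u_1\,dx\ne0$ there is a time $T\ge1$ (depending on the data) with $$E(t)\ge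 c\,|P_1|\,(1+t)^{\rho}\qquad\text{for all }t\ge T.$$ -/

import Mathlib

noncomputable section

namespace DoubleDamping

open MeasureTheory FourierTransform

/-- The space `ℝⁿ` with the Euclidean norm. -/
abbrev Rn (n : ℕ) : Type := EuclideanSpace ℝ (Fin n)

/-! ### Fourier transform, with the convention `∫ e^{-i x·ξ} f(x) dx`

Mathlib's `𝓕` uses the kernel `e^{-2πi x·ξ}`; evaluating it at `ξ / (2π)` gives the convention in
which `-Δ` has the symbol `|ξ|²`. -/

/-- The Fourier transform of an integrable function. -/
def hatL1 {n : ℕ} (f : Rn n → ℂ) (ξ : Rn n) : ℂ :=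
  𝓕 f ((2 * Real.pi)⁻¹ • ξ)

theorem hatL1_eq_integral {n : ℕ} (f : Rn n → ℂ) (ξ : Rn n) :
    hatL1 f ξ = ∫ x, Complex.exp (-(Complex.I * (inner ℝ x ξ : ℝ))) * f x := by
  rw [hatL1, Real.fourier_eq']
  refine integral_congr_ae (Filter.Eventually.of_forall fun x => ?_)
  have h : (-2 * Real.pi * inner ℝ x ((2 * Real.pi)⁻¹ • ξ) : ℝ) = -inner ℝ x ξ := by
    rw [inner_smul_right]
    field_simp
  simp only [smul_eq_mul, h]
  congr 2
  push_cast
  ring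

/-- The Fourier transform of an `L²` function. -/
def hatL2 {n : ℕ} (f : Lp ℂ 2 (volume : Measure (Rn n))) (ξ : Rn n) : ℂ :=
  (𝓕 f : Lp ℂ 2 (volume : Measure (Rn n))) ((2 * Real.pi)⁻¹ • ξ)

/-! ### Data space -/

/-- The `H^s` norm `‖⟨ξ⟩^s f̂‖_{L²}` of an integrable function `f`. -/
def normH {n : ℕ} (s : ℝ) (f : Rn n → ℂ) : ENNReal :=
  eLpNorm (fun ξ => (((1 + ‖ξ‖ ^ 2) ^ (s / 2) : ℝ) : ℂ) * hatL1 f ξ) 2 volume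

/-- `f ∈ H^s ∩ L¹`. -/
def MemHL1 {n : ℕ} (s : ℝ) (f : Rn n → ℂ) : Prop :=
  Integrable f ∧ normH s f < ⊤

/-- `(u₀, u₁) ∈ (H^s ∩ L¹) × (H^{[s - 2σ₂]⁺} ∩ L¹)`. -/
def MemData {n : ℕ} (σ₂ s : ℝ) (u₀ u₁ : Rn n → ℂ) : Prop :=
  MemHL1 s u₀ ∧ MemHL1 (max (s - 2 * σ₂) 0) u₁

/-- The norm of the data space. -/
def normData {n : ℕ} (σ₂ s : ℝ) (u₀ u₁ : Rn n → ℂ) : ENNReal :=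
  (eLpNorm u₀ 1 volume + normH s u₀) +
    (eLpNorm u₁ 1 volume + normH (max (s - 2 * σ₂) 0) u₁)

/-! ### The Cauchy problem -/

/-- `u` is an `L²`-valued solution of
`u_tt + (-Δ)^σ u + (-Δ)^σ₁ u_t + (-Δ)^σ₂ u_t = 0`, `u(0) = u₀`, `u_t(0) = u₁`.
The fractional Laplacian `(-Δ)^θ` is the multiplication of the Fourier transform by `|ξ|^{2θ}`, so
the equation and the initial conditions are imposed for the Fourier transform: `û(t, ·)` has a
representative `v t` (with time derivative `w t`) that solves the resulting second order ordinary
differential equation in `t` on `[0, ∞)` for almost every frequency `ξ`. -/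
def IsSolution {n : ℕ} (σ σ₁ σ₂ : ℝ) (u₀ u₁ : Rn n → ℂ)
    (u : ℝ → Lp ℂ 2 (volume : Measure (Rn n))) : Prop :=
  ∃ v w : ℝ → Rn n → ℂ,
    (∀ t, 0 ≤ t → hatL2 (u t) =ᵐ[volume] v t) ∧
    ∀ᵐ ξ ∂(volume : Measure (Rn n)),
      v 0 ξ = hatL1 u₀ ξ ∧ w 0 ξ = hatL1 u₁ ξ ∧
      ∀ t, 0 ≤ t →
        HasDerivWithinAt (fun τ => v τ ξ) (w t ξ) (Set.Ici 0) t ∧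
        HasDerivWithinAt (fun τ => w τ ξ)
          (-(((‖ξ‖ ^ (2 * σ) : ℝ) : ℂ) * v t ξ
            + ((‖ξ‖ ^ (2 * σ₁) + ‖ξ‖ ^ (2 * σ₂) : ℝ) : ℂ) * w t ξ)) (Set.Ici 0) t

/-! ### The asymptotic profiles -/

/-- `Γ₁(r, a) = (1 + a r^{2(σ₂-σ₁)})⁻¹`. -/
def Gam1 (σ₁ σ₂ r a : ℝ) : ℝ := (1 + a * r ^ (2 * (σ₂ - σ₁)))⁻¹

/-- `Γ₂(r, a, b) = (1 - 4 b r^{2(σ-2σ₁)} Γ₁(r, a)²)^{1/2}`. -/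
def Gam2 (σ σ₁ σ₂ r a b : ℝ) : ℝ :=
  Real.sqrt (1 - 4 * b * r ^ (2 * (σ - 2 * σ₁)) * Gam1 σ₁ σ₂ r a ^ 2)

/-- `λ₁⁰(r, a, b) = -2 r^{2(σ-σ₁)} Γ₁ (1 + Γ₂)⁻¹`. -/
def lam1 (σ σ₁ σ₂ r a b : ℝ) : ℝ :=
  -2 * r ^ (2 * (σ - σ₁)) * Gam1 σ₁ σ₂ r a * (1 + Gam2 σ σ₁ σ₂ r a b)⁻¹

/-- `G(r, a, b) = ((r^{2σ₁} + a r^{2σ₂})² - 4 b r^{2σ})^{1/2}`. -/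
def Gdisc (σ σ₁ σ₂ r a b : ℝ) : ℝ :=
  Real.sqrt ((r ^ (2 * σ₁) + a * r ^ (2 * σ₂)) ^ 2 - 4 * b * r ^ (2 * σ))

/-- `λ₂⁰(r, a, b) = -(r^{2σ₁} + a r^{2σ₂} + G(r, a, b)) / 2`. -/
def lam2 (σ σ₁ σ₂ r a b : ℝ) : ℝ :=
  -(1 / 2) * (r ^ (2 * σ₁) + a * r ^ (2 * σ₂) + Gdisc σ σ₁ σ₂ r a b)

/-- `K₀¹ = G⁻¹ λ₁⁰ e^{λ₂⁰ t}`. -/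
def K01 (σ σ₁ σ₂ t r a b : ℝ) : ℝ :=
  (Gdisc σ σ₁ σ₂ r a b)⁻¹ * lam1 σ σ₁ σ₂ r a b * Real.exp (lam2 σ σ₁ σ₂ r a b * t)

/-- `K₀² = G⁻¹ λ₂⁰ e^{λ₁⁰ t}`. -/
def K02 (σ σ₁ σ₂ t r a b : ℝ) : ℝ :=
  (Gdisc σ σ₁ σ₂ r a b)⁻¹ * lam2 σ σ₁ σ₂ r a b * Real.exp (lam1 σ σ₁ σ₂ r a b * t)

/-- `K₁¹ = G⁻¹ e^{λ₁⁰ t}`. -/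
def K11 (σ σ₁ σ₂ t r a b : ℝ) : ℝ :=
  (Gdisc σ σ₁ σ₂ r a b)⁻¹ * Real.exp (lam1 σ σ₁ σ₂ r a b * t)

/-- `K₁² = G⁻¹ e^{λ₂⁰ t}`. -/
def K12 (σ σ₁ σ₂ t r a b : ℝ) : ℝ :=
  (Gdisc σ σ₁ σ₂ r a b)⁻¹ * Real.exp (lam2 σ σ₁ σ₂ r a b * t)

/-- The mixed partial derivative `∂^{j+m} F / ∂a^j ∂b^m` at `(a, b) = (0, 0)`. -/
def mixedDeriv (F : ℝ → ℝ → ℝ) (j m : ℕ) : ℝ :=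
  iteratedDeriv j (fun a => iteratedDeriv m (fun b => F a b) 0) 0

/-- The Taylor polynomial of `F` of degree `k - 1` at `(0, 0)`, evaluated at `(1, 1)`: the sum of
`∂^{j+m} F (0,0) / (j! m!)` over `0 ≤ j + m ≤ k - 1`; it is `0` for `k = 0`. -/
def taylorSum (F : ℝ → ℝ → ℝ) (k : ℕ) : ℝ :=
  ∑ l ∈ Finset.range k, ∑ p ∈ Finset.HasAntidiagonal.antidiagonal l,
    mixedDeriv F p.1 p.2 / ((p.1.factorial : ℝ) * (p.2.factorial : ℝ))

/-- The profile `𝒜₀ᵏ(t, ξ)`, as a function of `r = |ξ|`. -/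
def A0 (σ σ₁ σ₂ : ℝ) (k : ℕ) (t r : ℝ) : ℝ :=
  taylorSum (K01 σ σ₁ σ₂ t r) k - taylorSum (K02 σ σ₁ σ₂ t r) k

/-- The profile `𝒜₁ᵏ(t, ξ)`, as a function of `r = |ξ|`. -/
def A1 (σ σ₁ σ₂ : ℝ) (k : ℕ) (t r : ℝ) : ℝ :=
  taylorSum (K11 σ σ₁ σ₂ t r) k - taylorSum (K12 σ σ₁ σ₂ t r) k

/-- `‖ |ξ|^s û(t,ξ) - |ξ|^s 𝒜₀ᵏ(t,ξ) û₀(ξ) - |ξ|^s 𝒜₁ᵏ(t,ξ) û₁(ξ) ‖_{L²}`. -/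
def expansionError {n : ℕ} (σ σ₁ σ₂ s : ℝ) (k : ℕ) (u₀ u₁ : Rn n → ℂ)
    (u : ℝ → Lp ℂ 2 (volume : Measure (Rn n))) (t : ℝ) : ENNReal :=
  eLpNorm (fun ξ : Rn n =>
    ((‖ξ‖ ^ s : ℝ) : ℂ) * hatL2 (u t) ξ
      - ((‖ξ‖ ^ s : ℝ) : ℂ) * ((A0 σ σ₁ σ₂ k t ‖ξ‖ : ℝ) : ℂ) * hatL1 u₀ ξ
      - ((‖ξ‖ ^ s : ℝ) : ℂ) * ((A1 σ σ₁ σ₂ k t ‖ξ‖ : ℝ) : ℂ) * hatL1 u₁ ξ) 2 volume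

/-- The exponent
`-n/(4(σ-σ₁)) - s/(2(σ-σ₁)) + σ₁/(σ-σ₁) - k δ/(σ-σ₁)` with `δ = min{σ₂-σ₁, σ-2σ₁}`. -/
def rate (n : ℕ) (σ σ₁ σ₂ s : ℝ) (k : ℕ) : ℝ :=
  -(n : ℝ) / (4 * (σ - σ₁)) - s / (2 * (σ - σ₁)) + σ₁ / (σ - σ₁)
    - (k : ℝ) * (min (σ₂ - σ₁) (σ - 2 * σ₁) / (σ - σ₁))

end DoubleDamping

end

/-! At a fixed frequency `r`, put `A = a r^{2(σ₂-σ₁)}` and `B = b r^{2(σ-2σ₁)}`. Each of the four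
kernels becomes a power of `r` times a function `Φ(A,B) exp(-x h(A,B))`, where `Φ` and `h` are
analytic near the origin with value 1 there, and `x` is `r^{2(σ-σ₁)} t` (slow root) or `r^{2σ₁} t`
(fast root). The true solution is the value at `a = b = 1`, that is at `A = r^{2(σ₂-σ₁)}`, `B =
r^{2(σ-2σ₁)}`; both are at most `r^{2δ}` for `r ≤ 1`. The error of the expansion is therefore a
Taylor remainder of order `k`, of size `r^{2δk}`.

Remainders are controlled by the weighted `ℓ¹` norm of double power series, which is
submultiplicative. Since `h - 1` has norm at most `1/2` on a small square, `exp(-x h)` has norm at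
most `exp(-x/2)` on a square that does not depend on `x` (`IsUnital.eventually_mul_exp`). This gives
the low frequency bound `r^{s-2σ₁+2δk} exp(-r^{2(σ-σ₁)} t/2)` (`exists_lowFrequency_bound`), whose
`L²` norm scales as `t^ρ`; the condition `n > 4σ₁` ensures integrability at the origin. At high
frequencies the solution decays exponentially by an energy estimate that needs no discussion of
real, double or complex roots (`exists_highFrequency_decay`), and the profiles decay by the same
norm bounds (`exists_profile_highFrequency_decay`).

For the lower bound, frequencies `r` comparable to a small multiple of `t^{-1/(2(σ-σ₁))}` are used
(`exists_parabolicZone_lower`). There the slow exponential is close to 1 and the fast one is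
negligible, so the error is governed by the Taylor remainder of `invDisc`, a function free of `t`.
Its degree `k` part does not vanish in the limiting direction of `(A,B)`, because along that ray
`invDisc` is a negative power `(1-κz)^{-α}` (`exists_le_abs_invDisc_sub_taylorSum`). The part from
`u₀` is smaller by a factor `r^{2σ₁}`, and `û₁` is close to `P₁` near the origin. An integration
over an annulus concludes. -/

noncomputable section

namespace DoubleDamping

open MeasureTheory FourierTransform Filter Topology

/-! ### Double power series under a weighted `ℓ¹` norm -/

/-- `F` is the sum of a double power series on the square `[-η, η]²`, whose weighted `ℓ¹` norm is
at most `M`. -/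
def HasDoubleSeries (η : ℝ) (F : ℝ → ℝ → ℝ) (M : ℝ) : Prop :=
  ∃ c : ℕ × ℕ → ℝ, Summable (fun e => |c e| * η ^ (e.1 + e.2)) ∧
    ∑' e, |c e| * η ^ (e.1 + e.2) ≤ M ∧
    ∀ A B, |A| ≤ η → |B| ≤ η → HasSum (fun e => c e * (A ^ e.1 * B ^ e.2)) (F A B)

theorem hasSum_of_eq {ι : Type*} {f g : ι → ℝ} {a : ℝ} (h : ∀ i, f i = g i) (hg : HasSum g a) :
    HasSum f a := by
  rwa [funext h]

theorem abs_monomial_le {η A B : ℝ} (hA : |A| ≤ η) (hB : |B| ≤ η) (i j : ℕ) :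
    |A ^ i * B ^ j| ≤ η ^ (i + j) := by
  rw [abs_mul, abs_pow, abs_pow, pow_add]
  have := (abs_nonneg A).trans hA
  gcongr

/-- Collecting the terms that share an exponent can only decrease the weighted norm, by the triangle
inequality on each fibre of `e`. Products and infinite sums of series are reduced to this
regrouping. -/
theorem HasDoubleSeries.of_family {ι : Type*} {η M : ℝ} {F : ℝ → ℝ → ℝ} (hη : 0 < η)
    (c : ι → ℝ) (e : ι → ℕ × ℕ)
    (hs : Summable fun i => |c i| * η ^ ((e i).1 + (e i).2))
    (hM : ∑' i, |c i| * η ^ ((e i).1 + (e i).2) ≤ M)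
    (hF : ∀ A B, |A| ≤ η → |B| ≤ η →
      HasSum (fun i => c i * (A ^ (e i).1 * B ^ (e i).2)) (F A B)) :
    HasDoubleSeries η F M := by
  have key := hs.hasSum.tsum_fiberwise e
  have hle : ∀ p : ℕ × ℕ, |∑' b : ↑(e ⁻¹' {p}), c b| * η ^ (p.1 + p.2) ≤
      ∑' b : ↑(e ⁻¹' {p}), |c b| * η ^ ((e b).1 + (e b).2) := by
    intro p
    have h0 : (fun b : ↑(e ⁻¹' {p}) => |c b| * η ^ ((e b).1 + (e b).2)) =
        fun b : ↑(e ⁻¹' {p}) => |c b| * η ^ (p.1 + p.2) := by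
      funext b
      have hb : e b = p := b.2
      rw [hb]
    have h1 : Summable fun b : ↑(e ⁻¹' {p}) => |c b| * η ^ (p.1 + p.2) := by
      rw [← h0]
      exact hs.subtype _
    have h2 : Summable fun b : ↑(e ⁻¹' {p}) => ‖c b‖ :=
      (summable_mul_right_iff (pow_pos hη _).ne').1 h1
    rw [h0, tsum_mul_right]
    gcongr
    exact norm_tsum_le_tsum_norm h2
  refine ⟨fun p => ∑' b : ↑(e ⁻¹' {p}), c b, ?_, ?_, ?_⟩
  · exact Summable.of_nonneg_of_le (fun p => by positivity) hle key.summable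
  · refine le_trans ?_ hM
    rw [← key.tsum_eq]
    exact Summable.tsum_le_tsum hle
      (Summable.of_nonneg_of_le (fun p => by positivity) hle key.summable) key.summable
  · intro A B hA hB
    have h1 : (fun p : ℕ × ℕ => (∑' b : ↑(e ⁻¹' {p}), c b) * (A ^ p.1 * B ^ p.2)) =
        fun p => ∑' b : ↑(e ⁻¹' {p}), c b * (A ^ (e b).1 * B ^ (e b).2) := by
      funext p
      rw [← tsum_mul_right]
      refine tsum_congr fun b => ?_
      have hb : e b = p := b.2
      rw [hb]
    rw [h1]
    exact (hF A B hA hB).tsum_fiberwise e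

namespace HasDoubleSeries

variable {η M M₁ M₂ : ℝ} {F F₁ F₂ : ℝ → ℝ → ℝ}

theorem congr (h : HasDoubleSeries η F M)
    (hF : ∀ A B, |A| ≤ η → |B| ≤ η → F₁ A B = F A B) (hM : M ≤ M₁) :
    HasDoubleSeries η F₁ M₁ := by
  obtain ⟨c, h1, h2, h3⟩ := h
  exact ⟨c, h1, h2.trans hM, fun A B hA hB => by rw [hF A B hA hB]; exact h3 A B hA hB⟩

theorem mono (h : HasDoubleSeries η F M) (hM : M ≤ M₁) : HasDoubleSeries η F M₁ :=
  h.congr (fun _ _ _ _ => rfl) hM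

theorem nonneg (hη : 0 ≤ η) (h : HasDoubleSeries η F M) : 0 ≤ M := by
  obtain ⟨c, -, h2, -⟩ := h
  exact le_trans (tsum_nonneg fun e => by positivity) h2

theorem abs_le (h : HasDoubleSeries η F M) {A B : ℝ} (hA : |A| ≤ η) (hB : |B| ≤ η) :
    |F A B| ≤ M := by
  obtain ⟨c, h1, h2, h3⟩ := h
  have hle : ∀ e : ℕ × ℕ, ‖c e * (A ^ e.1 * B ^ e.2)‖ ≤ |c e| * η ^ (e.1 + e.2) := fun e => by
    rw [Real.norm_eq_abs, abs_mul]
    gcongr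
    exact abs_monomial_le hA hB _ _
  rw [← (h3 A B hA hB).tsum_eq]
  exact (tsum_of_norm_bounded h1.hasSum hle).trans h2

theorem monomial (hη : 0 < η) (a : ℝ) (i j : ℕ) :
    HasDoubleSeries η (fun A B => a * (A ^ i * B ^ j)) (|a| * η ^ (i + j)) := by
  refine of_family (ι := Unit) hη (fun _ => a) (fun _ => (i, j)) ?_ ?_ ?_
  · exact (hasSum_fintype _).summable
  · simp
  · intro A B _ _
    simp

theorem const (hη : 0 < η) (a : ℝ) : HasDoubleSeries η (fun _ _ => a) |a| :=
  (monomial hη a 0 0).congr (by simp) (by simp)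

theorem fst (hη : 0 < η) : HasDoubleSeries η (fun A _ => A) η :=
  (monomial hη 1 1 0).congr (by simp) (by simp)

theorem snd (hη : 0 < η) : HasDoubleSeries η (fun _ B => B) η :=
  (monomial hη 1 0 1).congr (by simp) (by simp)

theorem mul (hη : 0 < η) (h₁ : HasDoubleSeries η F₁ M₁) (h₂ : HasDoubleSeries η F₂ M₂) :
    HasDoubleSeries η (fun A B => F₁ A B * F₂ A B) (M₁ * M₂) := by
  have hM₁ := h₁.nonneg hη.le
  obtain ⟨c₁, s₁, t₁, f₁⟩ := h₁
  obtain ⟨c₂, s₂, t₂, f₂⟩ := h₂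
  have e0 : (fun i : (ℕ × ℕ) × (ℕ × ℕ) =>
      |c₁ i.1 * c₂ i.2| * η ^ ((i.1 + i.2).1 + (i.1 + i.2).2)) =
      fun i => (|c₁ i.1| * η ^ (i.1.1 + i.1.2)) * (|c₂ i.2| * η ^ (i.2.1 + i.2.2)) := by
    funext i
    simp only [abs_mul, Prod.fst_add, Prod.snd_add]
    ring
  have hs := s₁.mul_of_nonneg s₂ (fun _ => by positivity) (fun _ => by positivity)
  refine of_family (ι := (ℕ × ℕ) × (ℕ × ℕ)) hη (fun i => c₁ i.1 * c₂ i.2)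
    (fun i => i.1 + i.2) ?_ ?_ ?_
  · rw [e0]
    exact hs
  · rw [e0, (s₁.hasSum.mul s₂.hasSum hs).tsum_eq]
    exact mul_le_mul t₁ t₂ (tsum_nonneg fun _ => by positivity) hM₁
  · intro A B hA hB
    have hle : ∀ i : (ℕ × ℕ) × (ℕ × ℕ),
        ‖(c₁ i.1 * (A ^ i.1.1 * B ^ i.1.2)) * (c₂ i.2 * (A ^ i.2.1 * B ^ i.2.2))‖ ≤
        (|c₁ i.1| * η ^ (i.1.1 + i.1.2)) * (|c₂ i.2| * η ^ (i.2.1 + i.2.2)) := fun i => by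
      rw [Real.norm_eq_abs, abs_mul, abs_mul (c₁ _), abs_mul (c₂ _)]
      gcongr
      · exact abs_monomial_le hA hB _ _
      · exact abs_monomial_le hA hB _ _
    refine hasSum_of_eq (fun i => ?_)
      ((f₁ A B hA hB).mul (f₂ A B hA hB) (Summable.of_norm_bounded hs hle))
    simp only [Prod.fst_add, Prod.snd_add]
    ring

theorem add (h₁ : HasDoubleSeries η F₁ M₁) (h₂ : HasDoubleSeries η F₂ M₂) (hη : 0 < η) :
    HasDoubleSeries η (fun A B => F₁ A B + F₂ A B) (M₁ + M₂) := by
  obtain ⟨c₁, s₁, t₁, f₁⟩ := h₁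
  obtain ⟨c₂, s₂, t₂, f₂⟩ := h₂
  have hle : ∀ e : ℕ × ℕ, |c₁ e + c₂ e| * η ^ (e.1 + e.2) ≤
      |c₁ e| * η ^ (e.1 + e.2) + |c₂ e| * η ^ (e.1 + e.2) := fun e => by
    rw [← add_mul]
    gcongr
    exact abs_add_le _ _
  have hs := Summable.of_nonneg_of_le (fun e => by positivity) hle (s₁.add s₂)
  refine ⟨fun e => c₁ e + c₂ e, hs, ?_, ?_⟩
  · refine (hs.tsum_le_tsum hle (s₁.add s₂)).trans ?_
    rw [s₁.tsum_add s₂]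
    exact add_le_add t₁ t₂
  · intro A B hA hB
    simpa only [add_mul] using (f₁ A B hA hB).add (f₂ A B hA hB)

theorem pow (hη : 0 < η) (h : HasDoubleSeries η F M) (n : ℕ) :
    HasDoubleSeries η (fun A B => F A B ^ n) (M ^ n) := by
  induction n with
  | zero => exact (const hη 1).congr (by simp) (by simp)
  | succ n ih => exact (mul hη ih h).congr (fun _ _ _ _ => pow_succ _ _) (pow_succ _ _).ge

/-- The doubly indexed family of all terms is absolutely summable with total norm at most `∑ m n`,
so the summations may be exchanged. -/
theorem hasSum {f : ℕ → ℝ → ℝ → ℝ} {m : ℕ → ℝ} (hη : 0 < η)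
    (hf : ∀ n, HasDoubleSeries η (f n) (m n)) (hm : Summable m)
    (hF : ∀ A B, |A| ≤ η → |B| ≤ η → HasSum (fun n => f n A B) (F A B)) :
    HasDoubleSeries η F (∑' n, m n) := by
  choose c s t g using hf
  have hs : Summable fun i : ℕ × (ℕ × ℕ) => |c i.1 i.2| * η ^ (i.2.1 + i.2.2) := by
    rw [summable_prod_of_nonneg (fun i => by positivity)]
    exact ⟨s, Summable.of_nonneg_of_le (fun n => tsum_nonneg fun _ => by positivity) t hm⟩
  refine of_family (ι := ℕ × (ℕ × ℕ)) hη (fun i => c i.1 i.2) (fun i => i.2) hs ?_ ?_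
  · have h1 := hs.hasSum.prod_fiberwise fun n => (s n).hasSum
    rw [← h1.tsum_eq]
    exact h1.summable.tsum_le_tsum t hm
  · intro A B hA hB
    have hle : ∀ i : ℕ × (ℕ × ℕ), ‖c i.1 i.2 * (A ^ i.2.1 * B ^ i.2.2)‖ ≤
        |c i.1 i.2| * η ^ (i.2.1 + i.2.2) := fun i => by
      rw [Real.norm_eq_abs, abs_mul]
      gcongr
      exact abs_monomial_le hA hB _ _
    have h1 := (Summable.of_norm_bounded hs hle).hasSum
    have h2 := h1.prod_fiberwise fun n => g n A B hA hB
    rwa [h2.unique (hF A B hA hB)] at h1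

/-- Composition with a power series in one variable. -/
theorem comp (hη : 0 < η) (h : HasDoubleSeries η F M) {f : ℝ → ℝ} {a : ℕ → ℝ}
    (ha : Summable fun n => |a n| * M ^ n)
    (hf : ∀ y, |y| ≤ M → HasSum (fun n => a n * y ^ n) (f y)) :
    HasDoubleSeries η (fun A B => f (F A B)) (∑' n, |a n| * M ^ n) :=
  hasSum hη (fun n => mul hη (const hη (a n)) (pow hη h n)) ha
    fun _ _ hA hB => hf _ (h.abs_le hA hB)

/-- Dropping the constant term of the exponential series makes the bound small for small `M`; the
lower bound of the theorem needs this smallness. -/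
theorem exp_sub_one (hη : 0 < η) (h : HasDoubleSeries η F M) :
    HasDoubleSeries η (fun A B => Real.exp (F A B) - 1) (Real.exp M - 1) := by
  have hexp : ∀ y : ℝ, HasSum (fun n : ℕ => (if n = 0 then 0 else (n.factorial : ℝ)⁻¹) * y ^ n)
      (Real.exp y - 1) := by
    intro y
    have h0 := NormedSpace.expSeries_div_hasSum_exp y
    rw [← Real.exp_eq_exp_ℝ] at h0
    have h1 := h0.sub (hasSum_ite_eq 0 (1 : ℝ))
    refine hasSum_of_eq (fun n => ?_) h1
    rcases eq_or_ne n 0 with rfl | hn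
    · simp
    · simp [hn, div_eq_inv_mul]
  have habs : (fun n : ℕ => |(if n = 0 then 0 else (n.factorial : ℝ)⁻¹ : ℝ)| * M ^ n) =
      fun n => (if n = 0 then 0 else (n.factorial : ℝ)⁻¹) * M ^ n := by
    funext n
    split_ifs
    · simp
    · rw [abs_of_nonneg (by positivity)]
  have hM := hexp M
  rw [← habs] at hM
  refine (comp hη h (f := fun y => Real.exp y - 1) hM.summable fun y _ => hexp y).mono ?_
  exact hM.tsum_eq.le

theorem exp (hη : 0 < η) (h : HasDoubleSeries η F M) :
    HasDoubleSeries η (fun A B => Real.exp (F A B)) (Real.exp M) :=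
  ((exp_sub_one hη h).add (const hη 1) hη).congr (fun _ _ _ _ => by ring) (by simp)

/-- The composition with an analytic function that vanishes at the origin. -/
theorem exists_comp_analytic {f : ℝ → ℝ} (hf : AnalyticAt ℝ f 0) (h0 : f 0 = 0) :
    ∃ C > 0, ∃ ρ > 0, ∀ {η M : ℝ} {F : ℝ → ℝ → ℝ}, 0 < η → M ≤ ρ → HasDoubleSeries η F M →
      HasDoubleSeries η (fun A B => f (F A B)) (C * M) := by
  obtain ⟨p, hp⟩ := hf
  obtain ⟨ε, hε, hsum⟩ := Metric.eventually_nhds_iff.1 (hasFPowerSeriesAt_iff.1 hp)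
  simp only [zero_add, smul_eq_mul, dist_zero_right, Real.norm_eq_abs] at hsum
  have hc0 : p.coeff 0 = 0 := by
    have h1 := hsum (y := 0) (by simpa using hε)
    have h2 : HasSum (fun n => (0 : ℝ) ^ n * p.coeff n) (p.coeff 0) := by
      simpa using hasSum_single (f := fun n => (0 : ℝ) ^ n * p.coeff n) 0
        (fun n hn => by simp [hn])
    rw [← h0, ← h1.unique h2]
  have hρ : 0 < ε / 2 := by positivity
  have hS : Summable fun n => |p.coeff n| * (ε / 2) ^ n := by
    have h1 := (hsum (y := ε / 2) (by rw [abs_of_pos hρ]; linarith)).summable.abs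
    refine h1.congr fun n => ?_
    rw [abs_mul, abs_of_pos (pow_pos hρ n), mul_comm]
  refine ⟨(∑' n, |p.coeff n| * (ε / 2) ^ n + 1) / (ε / 2), ?_, ε / 2, hρ, ?_⟩
  · have : 0 ≤ ∑' n, |p.coeff n| * (ε / 2) ^ n := tsum_nonneg fun _ => by positivity
    positivity
  intro η M F hη hM h
  have hM0 := h.nonneg hη.le
  -- As `f 0 = 0` there is no constant term, so every surviving term contains a factor `M` and the
  -- norm of the composition is linear in `M`.
  have hle : ∀ n, |p.coeff n| * M ^ n ≤ |p.coeff n| * (ε / 2) ^ n * (M / (ε / 2)) := by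
    intro n
    rcases n with - | n
    · simp [hc0]
    · rw [mul_assoc]
      gcongr
      have h1 : (ε / 2) ^ (n + 1) * (M / (ε / 2)) = (ε / 2) ^ n * M := by
        rw [pow_succ]
        field_simp
      rw [h1, pow_succ]
      gcongr
  have hs : Summable fun n => |p.coeff n| * M ^ n :=
    Summable.of_nonneg_of_le (fun _ => by positivity) hle (hS.mul_right _)
  refine (comp hη h hs (a := fun n => p.coeff n) fun y hy => ?_).mono ?_
  · simpa only [mul_comm] using hsum (y := y) (by linarith)
  · refine (hs.tsum_le_tsum hle (hS.mul_right _)).trans ?_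
    rw [tsum_mul_right, div_mul_eq_mul_div, ← mul_div_assoc]
    gcongr
    linarith

end HasDoubleSeries

/-! ### Germs with value 0 or 1 at the origin -/

/-- `F` is given near the origin by double power series of arbitrarily small weighted norm; in
particular it vanishes at the origin. -/
def IsSmall (F : ℝ → ℝ → ℝ) : Prop :=
  ∀ ε > 0, ∀ᶠ η in 𝓝[>] (0 : ℝ), HasDoubleSeries η F ε

namespace IsSmall

variable {F F₁ F₂ : ℝ → ℝ → ℝ}

theorem fst : IsSmall fun A _ => A := fun ε hε => by
  filter_upwards [Ioc_mem_nhdsGT hε] with η hη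
  exact (HasDoubleSeries.fst hη.1).mono hη.2

theorem snd : IsSmall fun _ B => B := fun ε hε => by
  filter_upwards [Ioc_mem_nhdsGT hε] with η hη
  exact (HasDoubleSeries.snd hη.1).mono hη.2

theorem add (h₁ : IsSmall F₁) (h₂ : IsSmall F₂) : IsSmall fun A B => F₁ A B + F₂ A B :=
  fun ε hε => by
  filter_upwards [h₁ _ (half_pos hε), h₂ _ (half_pos hε), self_mem_nhdsWithin] with η a b hη
  exact (a.add b hη).mono (by linarith)

theorem mul (h₁ : IsSmall F₁) (h₂ : IsSmall F₂) : IsSmall fun A B => F₁ A B * F₂ A B :=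
  fun ε hε => by
  filter_upwards [h₁ _ hε, h₂ 1 one_pos, self_mem_nhdsWithin] with η a b hη
  exact (a.mul hη b).mono (by linarith)

theorem const_mul (h : IsSmall F) (a : ℝ) : IsSmall fun A B => a * F A B := fun ε hε => by
  have h1 : 0 < ε / (|a| + 1) := by positivity
  filter_upwards [h _ h1, self_mem_nhdsWithin] with η b hη
  refine ((HasDoubleSeries.const hη a).mul hη b).mono ?_
  rw [← mul_div_assoc, div_le_iff₀ (by positivity)]
  nlinarith

theorem comp (h : IsSmall F) {f : ℝ → ℝ} (hf : AnalyticAt ℝ f 0) (h0 : f 0 = 0) :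
    IsSmall fun A B => f (F A B) := fun ε hε => by
  obtain ⟨C, hC, ρ, hρ, key⟩ := HasDoubleSeries.exists_comp_analytic hf h0
  filter_upwards [h (min ρ (ε / C)) (by positivity), self_mem_nhdsWithin] with η a hη
  refine (key hη (min_le_left _ _) a).mono ?_
  calc C * min ρ (ε / C) ≤ C * (ε / C) := by gcongr; exact min_le_right _ _
    _ = ε := by field_simp

end IsSmall

/-- `F` is analytic near the origin with value `1` there. -/
def IsUnital (F : ℝ → ℝ → ℝ) : Prop := IsSmall fun A B => F A B - 1

namespace IsUnital

variable {F F₁ F₂ : ℝ → ℝ → ℝ}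

theorem of_small_comp (h : IsSmall F) {f : ℝ → ℝ} (hf : AnalyticAt ℝ f 0) (h0 : f 0 = 1) :
    IsUnital fun A B => f (F A B) :=
  h.comp (f := fun y => f y - 1) (hf.sub analyticAt_const) (by simp [h0])

theorem mul (h₁ : IsUnital F₁) (h₂ : IsUnital F₂) : IsUnital fun A B => F₁ A B * F₂ A B := by
  have h := (h₁.add h₂).add (IsSmall.mul h₁ h₂)
  unfold IsUnital
  convert h using 3
  ring

theorem eventually_hasDoubleSeries (h : IsUnital F) :
    ∀ᶠ η in 𝓝[>] (0 : ℝ), HasDoubleSeries η F 2 := by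
  filter_upwards [h 1 one_pos, self_mem_nhdsWithin] with η a hη
  exact (a.add (HasDoubleSeries.const hη 1) hη).congr (fun _ _ _ _ => by ring) (by norm_num)

end IsUnital

/-! ### Taylor sums and Taylor remainders -/

theorem iteratedDeriv_zero_of_hasSum {d : ℕ → ℝ} {f : ℝ → ℝ} {η : ℝ} (hη : 0 < η)
    (h : ∀ b, |b| ≤ η → HasSum (fun m => d m * b ^ m) (f b)) (m : ℕ) :
    iteratedDeriv m f 0 = m.factorial * d m := by
  have h1 : HasFPowerSeriesAt f (FormalMultilinearSeries.ofScalars ℝ d) 0 := by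
    rw [hasFPowerSeriesAt_iff]
    filter_upwards [Metric.closedBall_mem_nhds (0 : ℝ) hη] with z hz
    simp only [FormalMultilinearSeries.coeff_ofScalars, zero_add, smul_eq_mul]
    refine hasSum_of_eq (fun n => mul_comm _ _) (h z ?_)
    simpa using hz
  have h2 := h1.eq_formalMultilinearSeries h1.analyticAt.hasFPowerSeriesAt
  have h3 := congrArg (fun p => FormalMultilinearSeries.coeff p m) h2
  simp only [FormalMultilinearSeries.coeff_ofScalars] at h3
  rw [h3]
  field_simp

/-- The mixed derivatives at the origin of a rescaled sum of a double power series. -/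
theorem mixedDeriv_of_hasSum {η : ℝ} (hη : 0 < η) {c : ℕ × ℕ → ℝ} {F G : ℝ → ℝ → ℝ}
    (hs : Summable fun e => |c e| * η ^ (e.1 + e.2))
    (hF : ∀ A B, |A| ≤ η → |B| ≤ η → HasSum (fun e => c e * (A ^ e.1 * B ^ e.2)) (F A B))
    {κ p q : ℝ} (hG : ∀ a b, |p * a| ≤ η → |q * b| ≤ η → G a b = κ * F (p * a) (q * b))
    (j m : ℕ) :
    mixedDeriv G j m = κ * (c (j, m) * (p ^ j * q ^ m)) * (j.factorial * m.factorial) := by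
  obtain ⟨ε, hε, hp, hq⟩ : ∃ ε > 0, |p| * ε ≤ η ∧ |q| * ε ≤ η := by
    refine ⟨η / (|p| + |q| + 1), by positivity, ?_, ?_⟩
    · rw [mul_div_assoc', div_le_iff₀ (by positivity)]
      nlinarith [abs_nonneg p, abs_nonneg q]
    · rw [mul_div_assoc', div_le_iff₀ (by positivity)]
      nlinarith [abs_nonneg p, abs_nonneg q]
  have hbd : ∀ {r a : ℝ}, |r| * ε ≤ η → |a| ≤ ε → |r * a| ≤ η := fun {r a} h1 h2 => by
    rw [abs_mul]
    exact (mul_le_mul_of_nonneg_left h2 (abs_nonneg r)).trans h1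
  have hrow : ∀ m A, |A| ≤ η → Summable fun j => c (j, m) * A ^ j := by
    intro m A hA
    have h1 : Summable fun j => |c (j, m)| * η ^ j := by
      have h2 := hs.comp_injective (i := fun j : ℕ => (j, m)) fun a b hab => by simpa using hab
      refine (summable_mul_right_iff (pow_pos hη m).ne').1 (h2.congr fun j => ?_)
      simp only [Function.comp]
      ring
    refine Summable.of_norm_bounded h1 fun j => ?_
    rw [Real.norm_eq_abs, abs_mul, abs_pow]
    gcongr
  have hinner : ∀ m a, |a| ≤ ε → iteratedDeriv m (fun b => G a b) 0 =
      m.factorial * (κ * (q ^ m * ∑' j, c (j, m) * (p * a) ^ j)) := by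
    intro m a ha
    refine iteratedDeriv_zero_of_hasSum
      (d := fun m => κ * (q ^ m * ∑' j, c (j, m) * (p * a) ^ j)) hε (fun b hb => ?_) m
    have ha' := hbd hp ha
    have hb' := hbd hq hb
    rw [hG a b ha' hb']
    have h1 := ((Equiv.prodComm ℕ ℕ).hasSum_iff.2 (hF _ _ ha' hb')).prod_fiberwise
      (g := fun m => (∑' j, c (j, m) * (p * a) ^ j) * (q * b) ^ m) fun m => by
        refine hasSum_of_eq (fun j => ?_) ((hrow m _ ha').hasSum.mul_right ((q * b) ^ m))
        simp only [Function.comp, Equiv.prodComm_apply, Prod.swap]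
        ring
    refine hasSum_of_eq (fun m => ?_) (h1.mul_left κ)
    rw [mul_pow]
    ring
  have houter := iteratedDeriv_zero_of_hasSum (f := fun a => iteratedDeriv m (fun b => G a b) 0)
    (d := fun j => m.factorial * (κ * (q ^ m * (c (j, m) * p ^ j)))) hε (fun a ha => by
      rw [hinner m a ha]
      refine hasSum_of_eq (fun j => ?_)
        ((((hrow m _ (hbd hp ha)).hasSum.mul_left (q ^ m)).mul_left κ).mul_left
          (m.factorial : ℝ))
      rw [mul_pow]
      ring) j
  rw [mixedDeriv, houter]
  ring

/-- The pairs of exponents of total degree less than `k`. -/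
def lowDegrees (k : ℕ) : Finset (ℕ × ℕ) :=
  (Finset.range k).biUnion Finset.HasAntidiagonal.antidiagonal

theorem mem_lowDegrees {k : ℕ} {e : ℕ × ℕ} : e ∈ lowDegrees k ↔ e.1 + e.2 < k := by
  simp [lowDegrees]

theorem sum_lowDegrees (k : ℕ) (f : ℕ × ℕ → ℝ) :
    ∑ e ∈ lowDegrees k, f e =
      ∑ l ∈ Finset.range k, ∑ e ∈ Finset.HasAntidiagonal.antidiagonal l, f e := by
  refine Finset.sum_biUnion fun a _ b _ hab => ?_
  rw [Function.onFun, Finset.disjoint_left]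
  intro e he he'
  rw [Finset.HasAntidiagonal.mem_antidiagonal] at he he'
  exact hab (he.symm.trans he')

theorem taylorSum_of_hasSum {η : ℝ} (hη : 0 < η) {c : ℕ × ℕ → ℝ} {F G : ℝ → ℝ → ℝ}
    (hs : Summable fun e => |c e| * η ^ (e.1 + e.2))
    (hF : ∀ A B, |A| ≤ η → |B| ≤ η → HasSum (fun e => c e * (A ^ e.1 * B ^ e.2)) (F A B))
    {κ p q : ℝ} (hG : ∀ a b, |p * a| ≤ η → |q * b| ≤ η → G a b = κ * F (p * a) (q * b))
    (k : ℕ) :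
    taylorSum G k = κ * ∑ e ∈ lowDegrees k, c e * (p ^ e.1 * q ^ e.2) := by
  rw [taylorSum, ← sum_lowDegrees k fun e =>
    mixedDeriv G e.1 e.2 / ((e.1.factorial : ℝ) * (e.2.factorial : ℝ)), Finset.mul_sum]
  refine Finset.sum_congr rfl fun e _ => ?_
  rw [mixedDeriv_of_hasSum hη hs hF hG]
  have h1 : (e.1.factorial : ℝ) ≠ 0 := by positivity
  have h2 : (e.2.factorial : ℝ) ≠ 0 := by positivity
  field_simp

/-- Only monomials of degree at least `k` remain, and shrinking the point by `θ ≤ 1` multiplies each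
of them by at most `θ ^ k`. -/
theorem abs_sub_sum_lowDegrees_le {η M : ℝ} {c : ℕ × ℕ → ℝ} {F : ℝ → ℝ → ℝ} (hη : 0 < η)
    (hs : Summable fun e => |c e| * η ^ (e.1 + e.2))
    (hM : ∑' e, |c e| * η ^ (e.1 + e.2) ≤ M)
    (hF : ∀ A B, |A| ≤ η → |B| ≤ η → HasSum (fun e => c e * (A ^ e.1 * B ^ e.2)) (F A B))
    {θ p q : ℝ} (h0 : 0 ≤ θ) (h1 : θ ≤ 1) (hp : |p| ≤ θ * η) (hq : |q| ≤ θ * η) (k : ℕ) :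
    |F p q - ∑ e ∈ lowDegrees k, c e * (p ^ e.1 * q ^ e.2)| ≤ θ ^ k * M := by
  have hθη : θ * η ≤ η := mul_le_of_le_one_left hη.le h1
  have hsub := (hF p q (hp.trans hθη) (hq.trans hθη)).sub
    (hasSum_sum_of_ne_finset_zero (s := lowDegrees k)
      (f := fun e => if e ∈ lowDegrees k then c e * (p ^ e.1 * q ^ e.2) else 0)
      fun e he => by simp [he])
  rw [Finset.sum_congr rfl fun e he => if_pos he] at hsub
  have hle : ∀ e : ℕ × ℕ, ‖c e * (p ^ e.1 * q ^ e.2) -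
      (if e ∈ lowDegrees k then c e * (p ^ e.1 * q ^ e.2) else 0)‖ ≤
      θ ^ k * (|c e| * η ^ (e.1 + e.2)) := by
    intro e
    split_ifs with he
    · simp only [sub_self, norm_zero]
      positivity
    · rw [mem_lowDegrees, not_lt] at he
      rw [sub_zero, Real.norm_eq_abs, abs_mul, mul_left_comm]
      gcongr
      refine (abs_monomial_le hp hq _ _).trans ?_
      rw [mul_pow]
      gcongr ?_ * _
      exact pow_le_pow_of_le_one h0 h1 he
  rw [← hsub.tsum_eq]
  refine (tsum_of_norm_bounded (hs.hasSum.mul_left (θ ^ k)) hle).trans ?_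
  gcongr

theorem HasDoubleSeries.abs_sub_taylorSum_le {η M : ℝ} {F G : ℝ → ℝ → ℝ} (hη : 0 < η)
    (h : HasDoubleSeries η F M) {κ p q θ : ℝ}
    (hG : ∀ a b, |p * a| ≤ η → |q * b| ≤ η → G a b = κ * F (p * a) (q * b))
    (h0 : 0 ≤ θ) (h1 : θ ≤ 1) (hp : |p| ≤ θ * η) (hq : |q| ≤ θ * η) (k : ℕ) :
    |κ * F p q - taylorSum G k| ≤ |κ| * (θ ^ k * M) := by
  obtain ⟨c, s, t, f⟩ := h
  rw [taylorSum_of_hasSum hη s f hG, ← mul_sub, abs_mul]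
  gcongr
  exact abs_sub_sum_lowDegrees_le hη s t f h0 h1 hp hq k

/-- The Taylor sum is a polynomial of degree less than `k`, so it can be bounded outside the square
of convergence too, where it grows by at most `θ ^ k`. This serves the high frequencies, at which
`(p, q)` leaves the square. -/
theorem HasDoubleSeries.abs_taylorSum_le {η M : ℝ} {F G : ℝ → ℝ → ℝ} (hη : 0 < η)
    (h : HasDoubleSeries η F M) {κ p q θ : ℝ}
    (hG : ∀ a b, |p * a| ≤ η → |q * b| ≤ η → G a b = κ * F (p * a) (q * b))
    (h1 : 1 ≤ θ) (hp : |p| ≤ θ * η) (hq : |q| ≤ θ * η) (k : ℕ) :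
    |taylorSum G k| ≤ |κ| * (θ ^ k * M) := by
  obtain ⟨c, s, t, f⟩ := h
  rw [taylorSum_of_hasSum hη s f hG, abs_mul]
  gcongr
  calc |∑ e ∈ lowDegrees k, c e * (p ^ e.1 * q ^ e.2)|
      ≤ ∑ e ∈ lowDegrees k, |c e * (p ^ e.1 * q ^ e.2)| := Finset.abs_sum_le_sum_abs _ _
    _ ≤ ∑ e ∈ lowDegrees k, θ ^ k * (|c e| * η ^ (e.1 + e.2)) := by
        refine Finset.sum_le_sum fun e he => ?_
        rw [mem_lowDegrees] at he
        rw [abs_mul, mul_left_comm]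
        gcongr
        refine (abs_monomial_le hp hq _ _).trans ?_
        rw [mul_pow]
        gcongr
    _ = θ ^ k * ∑ e ∈ lowDegrees k, |c e| * η ^ (e.1 + e.2) := (Finset.mul_sum _ _ _).symm
    _ ≤ θ ^ k * M := by
        gcongr
        exact (s.sum_le_tsum _ fun _ _ => by positivity).trans t

/-- This allows the slow kernel to be split into its part free of `t` and a correction, while the
Taylor sum of the whole kernel is what occurs in the profile. -/
theorem HasDoubleSeries.taylorSum_add {η M₁ M₂ : ℝ} {F₁ F₂ G : ℝ → ℝ → ℝ} (hη : 0 < η)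
    (h₁ : HasDoubleSeries η F₁ M₁) (h₂ : HasDoubleSeries η F₂ M₂) {κ p q : ℝ}
    (hG : ∀ a b, |p * a| ≤ η → |q * b| ≤ η →
      G a b = κ * (F₁ (p * a) (q * b) + F₂ (p * a) (q * b))) (k : ℕ) :
    taylorSum G k = κ * (taylorSum (fun a b => F₁ (p * a) (q * b)) k +
      taylorSum (fun a b => F₂ (p * a) (q * b)) k) := by
  obtain ⟨c₁, s₁, t₁, f₁⟩ := h₁
  obtain ⟨c₂, s₂, t₂, f₂⟩ := h₂
  have hle : ∀ e : ℕ × ℕ, |c₁ e + c₂ e| * η ^ (e.1 + e.2) ≤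
      |c₁ e| * η ^ (e.1 + e.2) + |c₂ e| * η ^ (e.1 + e.2) := fun e => by
    rw [← add_mul]
    gcongr
    exact abs_add_le _ _
  have hs := Summable.of_nonneg_of_le (fun e => by positivity) hle (s₁.add s₂)
  have hf : ∀ A B, |A| ≤ η → |B| ≤ η →
      HasSum (fun e : ℕ × ℕ => (c₁ e + c₂ e) * (A ^ e.1 * B ^ e.2)) (F₁ A B + F₂ A B) :=
    fun A B hA hB => by simpa only [add_mul] using (f₁ A B hA hB).add (f₂ A B hA hB)
  rw [taylorSum_of_hasSum hη hs (F := fun A B => F₁ A B + F₂ A B) hf hG,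
    taylorSum_of_hasSum hη s₁ f₁ (κ := 1) (fun a b _ _ => (one_mul _).symm),
    taylorSum_of_hasSum hη s₂ f₂ (κ := 1) (fun a b _ _ => (one_mul _).symm),
    one_mul, one_mul, ← Finset.sum_add_distrib]
  simp only [add_mul]

/-- Each differentiation yields the nonzero factor `κ α` and replaces `α` by `α + 1 > 0`, so no
derivative vanishes at 0. -/
theorem iteratedDeriv_rpow_one_sub_mul_ne_zero {κ : ℝ} (hκ : κ ≠ 0) (k : ℕ) :
    ∀ α : ℝ, 0 < α → iteratedDeriv k (fun z : ℝ => (1 - κ * z) ^ (-α)) 0 ≠ 0 := by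
  induction k with
  | zero => intro α _; simp
  | succ k ih =>
    intro α hα
    have h1 : deriv (fun z : ℝ => (1 - κ * z) ^ (-α)) =ᶠ[𝓝 0]
        fun z => (κ * α) * (1 - κ * z) ^ (-(α + 1)) := by
      have hpos : ∀ᶠ z : ℝ in 𝓝 0, 0 < 1 - κ * z := by
        have hc : Continuous fun z : ℝ => 1 - κ * z := by fun_prop
        exact hc.continuousAt.eventually (lt_mem_nhds (by simp))
      filter_upwards [hpos] with z hz
      have h2 : HasDerivAt (fun z : ℝ => 1 - κ * z) (-κ) z := by
        simpa using ((hasDerivAt_id z).const_mul κ).const_sub 1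
      rw [(h2.rpow_const (p := -α) (Or.inl hz.ne')).deriv, neg_add, ← sub_eq_add_neg]
      ring
    rw [iteratedDeriv_succ', h1.iteratedDeriv_eq, iteratedDeriv_const_mul_field]
    exact mul_ne_zero (mul_ne_zero hκ hα.ne') (ih _ (by linarith))

/-- A lower bound for the Taylor remainder near a direction `(u, v)` in which the function is a
negative power. -/
theorem HasDoubleSeries.exists_le_abs_sub_taylorSum {η M : ℝ} {F : ℝ → ℝ → ℝ} (hη : 0 < η)
    (h : HasDoubleSeries η F M) {u v κ α : ℝ} (hκ : κ ≠ 0) (hα : 0 < α)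
    (hF : ∀ᶠ z in 𝓝 (0 : ℝ), F (z * u) (z * v) = (1 - κ * z) ^ (-α)) (k : ℕ) :
    ∃ c > 0, ∀ᶠ w in 𝓝[>] (0 : ℝ) ×ˢ 𝓝 (u, v),
      c * w.1 ^ k ≤ |F (w.1 * w.2.1) (w.1 * w.2.2) -
        taylorSum (fun a b => F (w.1 * w.2.1 * a) (w.1 * w.2.2 * b)) k| := by
  have hM := h.nonneg hη.le
  obtain ⟨c, s, t, f⟩ := h
  set L : ℝ × ℝ → ℝ := fun w => ∑ e ∈ Finset.HasAntidiagonal.antidiagonal k,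
    c e * (w.1 ^ e.1 * w.2 ^ e.2) with hL
  obtain ⟨ε, hε, hu, hv⟩ : ∃ ε > 0, |u| * ε ≤ η ∧ |v| * ε ≤ η := by
    refine ⟨η / (|u| + |v| + 1), by positivity, ?_, ?_⟩
    · rw [mul_div_assoc', div_le_iff₀ (by positivity)]
      nlinarith [abs_nonneg u, abs_nonneg v]
    · rw [mul_div_assoc', div_le_iff₀ (by positivity)]
      nlinarith [abs_nonneg u, abs_nonneg v]
  have hbd : ∀ {r a : ℝ}, |r| * ε ≤ η → |a| ≤ ε → |a * r| ≤ η := fun {r a} h1 h2 => by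
    rw [mul_comm, abs_mul]
    exact (mul_le_mul_of_nonneg_left h2 (abs_nonneg r)).trans h1
  -- `L (u, v)` is the coefficient of `z ^ k` in `F (z u) (z v)`, which is a negative power of `1 -
  -- κ z`.
  have hLne : L (u, v) ≠ 0 := by
    have h1 := iteratedDeriv_zero_of_hasSum (f := fun z => F (z * u) (z * v))
      (d := fun l => ∑ e ∈ Finset.HasAntidiagonal.antidiagonal l, c e * (u ^ e.1 * v ^ e.2))
      hε (fun z hz => by
        have h2 := (f _ _ (hbd hu hz) (hbd hv hz)).tsum_fiberwise fun e => e.1 + e.2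
        refine hasSum_of_eq (fun l => ?_) h2
        have h3 : (fun e : ℕ × ℕ => e.1 + e.2) ⁻¹' {l} =
            ↑(Finset.HasAntidiagonal.antidiagonal l) := by
          ext e
          simp
        rw [h3, Finset.tsum_subtype' (Finset.HasAntidiagonal.antidiagonal l)
          (fun e : ℕ × ℕ => c e * ((z * u) ^ e.1 * (z * v) ^ e.2)), Finset.sum_mul]
        refine Finset.sum_congr rfl fun e he => ?_
        rw [Finset.HasAntidiagonal.mem_antidiagonal] at he
        rw [← he, mul_pow, mul_pow, pow_add]
        ring) k
    have h2 : iteratedDeriv k (fun z => F (z * u) (z * v)) 0 ≠ 0 := by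
      rw [Filter.EventuallyEq.iteratedDeriv_eq k hF]
      exact iteratedDeriv_rpow_one_sub_mul_ne_zero hκ k α hα
    rw [h1] at h2
    exact right_ne_zero_of_mul h2
  have hLc : Continuous L := by
    rw [hL]
    fun_prop
  have hLpos : 0 < |L (u, v)| := abs_pos.2 hLne
  set b : ℝ := |u| + |v| + 1 with hb
  have hb0 : 0 < b := by positivity
  refine ⟨|L (u, v)| / 4, by positivity, ?_⟩
  -- The first condition keeps the point in the square of convergence; the second makes the
  -- remainder of order `k + 1` at most a quarter of `|L (u, v)| z ^ k`, against the half of it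
  -- guaranteed by the continuity of `L`.
  have hsmall : ∀ᶠ z in 𝓝[>] (0 : ℝ), z * (b / η) ≤ 1 ∧
      z * ((b / η) ^ (k + 1) * M) ≤ |L (u, v)| / 4 ∧ 0 < z := by
    have h1 : ∀ a c : ℝ, 0 < c → ∀ᶠ z in 𝓝[>] (0 : ℝ), z * a ≤ c := fun a c hc => by
      have h2 : Tendsto (fun z : ℝ => z * a) (𝓝[>] 0) (𝓝 0) := by
        have h3 : Continuous fun z : ℝ => z * a := by fun_prop
        simpa using (h3.tendsto 0).mono_left nhdsWithin_le_nhds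
      exact h2.eventually (ge_mem_nhds hc)
    exact (h1 _ _ one_pos).and ((h1 _ _ (by positivity)).and self_mem_nhdsWithin)
  have hnear : ∀ᶠ w in 𝓝 (u, v), |L (u, v)| / 2 ≤ |L w| ∧ |w.1| ≤ b ∧ |w.2| ≤ b := by
    refine ((hLc.abs.tendsto (u, v)).eventually (le_mem_nhds (by linarith))).and (.and ?_ ?_)
    · exact (continuous_fst.abs.tendsto (u, v)).eventually
        (ge_mem_nhds (by simp only [hb]; linarith [abs_nonneg v]))
    · exact (continuous_snd.abs.tendsto (u, v)).eventually
        (ge_mem_nhds (by simp only [hb]; linarith [abs_nonneg u]))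
  filter_upwards [hsmall.prod_mk hnear] with w hw
  obtain ⟨⟨hz1, hz2, hz0⟩, hw1, hw2, hw3⟩ := hw
  obtain ⟨z, u', v'⟩ := w
  simp only at hz1 hz2 hz0 hw1 hw2 hw3 ⊢
  have hsc : ∀ a, |a| ≤ b → |z * a| ≤ z * (b / η) * η := fun a ha => by
    rw [abs_mul, abs_of_pos hz0, mul_assoc, div_mul_cancel₀ _ hη.ne']
    gcongr
  have hrem := abs_sub_sum_lowDegrees_le hη s t f (θ := z * (b / η)) (by positivity) hz1
    (hsc u' hw2) (hsc v' hw3) (k + 1)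
  rw [taylorSum_of_hasSum hη s f (κ := 1) (fun a b _ _ => (one_mul _).symm), one_mul]
  have hstep : ∑ e ∈ lowDegrees (k + 1), c e * ((z * u') ^ e.1 * (z * v') ^ e.2) =
      ∑ e ∈ lowDegrees k, c e * ((z * u') ^ e.1 * (z * v') ^ e.2) + z ^ k * L (u', v') := by
    rw [sum_lowDegrees, sum_lowDegrees, Finset.sum_range_succ, hL, Finset.mul_sum]
    congr 1
    refine Finset.sum_congr rfl fun e he => ?_
    rw [Finset.HasAntidiagonal.mem_antidiagonal] at he
    rw [← he, mul_pow, mul_pow, pow_add]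
    ring
  rw [hstep] at hrem
  set S := ∑ e ∈ lowDegrees k, c e * ((z * u') ^ e.1 * (z * v') ^ e.2)
  have hzk : 0 < z ^ k := pow_pos hz0 k
  have h1 : z ^ k * |L (u', v')| ≤ |F (z * u') (z * v') - S| +
      |F (z * u') (z * v') - (S + z ^ k * L (u', v'))| := by
    have h2 := abs_sub (F (z * u') (z * v') - S) (F (z * u') (z * v') - (S + z ^ k * L (u', v')))
    have h3 : F (z * u') (z * v') - S - (F (z * u') (z * v') - (S + z ^ k * L (u', v'))) =
        z ^ k * L (u', v') := by ring
    rwa [h3, abs_mul, abs_of_pos hzk] at h2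
  have h4 : (z * (b / η)) ^ (k + 1) * M = z ^ k * (z * ((b / η) ^ (k + 1) * M)) := by
    rw [mul_pow, pow_succ z]
    ring
  rw [h4] at hrem
  have h5 := mul_le_mul_of_nonneg_left hz2 hzk.le
  have h6 := mul_le_mul_of_nonneg_left hw1 hzk.le
  linarith

/-! ### The symbols as analytic functions of the scaled variables -/

/-- `Γ₂` in the variables `A = a r^{2(σ₂-σ₁)}`, `B = b r^{2(σ-2σ₁)}`. -/
def rootDisc (A B : ℝ) : ℝ := Real.sqrt (1 - 4 * B * (1 + A)⁻¹ ^ 2)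

/-- `r^{2σ₁} / G` in the variables `A`, `B`. -/
def invDisc (A B : ℝ) : ℝ := (1 + A)⁻¹ * (rootDisc A B)⁻¹

/-- `-λ₁⁰ / r^{2(σ-σ₁)}` in the variables `A`, `B`. -/
def slowRoot (A B : ℝ) : ℝ := (1 + A)⁻¹ * (2 * (1 + rootDisc A B)⁻¹)

/-- `-λ₂⁰ / r^{2σ₁}` in the variables `A`, `B`. -/
def fastRoot (A B : ℝ) : ℝ := (1 + A) * ((1 + rootDisc A B) / 2)

theorem isUnital_one_add : IsUnital fun A _ => 1 + A := by
  simpa only [IsUnital, add_sub_cancel_left] using IsSmall.fst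

theorem isUnital_inv_one_add : IsUnital fun A _ => (1 + A)⁻¹ :=
  IsUnital.of_small_comp (F := fun A _ => A) IsSmall.fst (f := fun y => (1 + y)⁻¹)
    ((analyticAt_const.add analyticAt_id).inv (by simp)) (by simp)

theorem isSmall_disc : IsSmall fun A B => 4 * B * (1 + A)⁻¹ ^ 2 := by
  have h := isUnital_inv_one_add.mul isUnital_inv_one_add
  have h1 := (IsSmall.snd.add (IsSmall.snd.mul h)).const_mul 4
  convert h1 using 3
  ring

theorem analyticAt_sqrt_one_sub : AnalyticAt ℝ (fun y : ℝ => Real.sqrt (1 - y)) 0 := by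
  have h1 : AnalyticAt ℝ Real.sqrt ((fun y : ℝ => 1 - y) 0) :=
    (Real.contDiffAt_sqrt (n := ⊤) (by norm_num)).analyticAt
  exact h1.comp (analyticAt_const.sub analyticAt_id)

theorem isUnital_invDisc : IsUnital invDisc :=
  isUnital_inv_one_add.mul (IsUnital.of_small_comp isSmall_disc
    (f := fun y => (Real.sqrt (1 - y))⁻¹) (analyticAt_sqrt_one_sub.inv (by simp)) (by simp))

theorem isUnital_slowRoot : IsUnital slowRoot :=
  isUnital_inv_one_add.mul (IsUnital.of_small_comp isSmall_disc
    (f := fun y => 2 * (1 + Real.sqrt (1 - y))⁻¹)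
    (analyticAt_const.mul ((analyticAt_const.add analyticAt_sqrt_one_sub).inv
      (by simp))) (by norm_num))

theorem isUnital_fastRoot : IsUnital fastRoot :=
  isUnital_one_add.mul (IsUnital.of_small_comp isSmall_disc
    (f := fun y => (1 + Real.sqrt (1 - y)) / 2)
    ((analyticAt_const.add analyticAt_sqrt_one_sub).div analyticAt_const
      (by norm_num)) (by norm_num))

/-- Write `exp(-x h) = exp(-x) exp(-x (h - 1))`: if `h - 1` has norm at most `1/2`, the second
factor has norm at most `exp(x/2)`. The radius `η` is chosen before `x`, hence is uniform in `r` and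
`t`. -/
theorem IsUnital.eventually_mul_exp {Φ h : ℝ → ℝ → ℝ} (hΦ : IsUnital Φ) (hh : IsUnital h) :
    ∀ᶠ η in 𝓝[>] (0 : ℝ), ∀ x, 0 ≤ x →
      HasDoubleSeries η (fun A B => Φ A B * Real.exp (-x * h A B)) (2 * Real.exp (-x / 2)) := by
  filter_upwards [hΦ.eventually_hasDoubleSeries, hh (1 / 2) (by norm_num),
    self_mem_nhdsWithin] with η h1 h2 hη x hx
  have h3 := ((HasDoubleSeries.const hη (-x)).mul hη h2).exp hη
  have h4 := (HasDoubleSeries.const hη (Real.exp (-x))).mul hη h3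
  refine (h1.mul hη h4).congr (fun A B _ _ => ?_) ?_
  · rw [← Real.exp_add]
    congr 2
    ring
  · rw [Real.abs_exp, ← Real.exp_add, abs_neg, abs_of_nonneg hx]
    apply le_of_eq
    congr 2
    ring

theorem IsUnital.eventually_mul_exp_sub_one {Φ h : ℝ → ℝ → ℝ} (hΦ : IsUnital Φ)
    (hh : IsUnital h) :
    ∀ᶠ η in 𝓝[>] (0 : ℝ), ∀ x, 0 ≤ x →
      HasDoubleSeries η (fun A B => Φ A B * (Real.exp (-x * h A B) - 1))
        (2 * (Real.exp (2 * x) - 1)) := by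
  filter_upwards [hΦ.eventually_hasDoubleSeries, hh.eventually_hasDoubleSeries,
    self_mem_nhdsWithin] with η h1 h2 hη x hx
  have h3 := ((HasDoubleSeries.const hη (-x)).mul hη h2).exp_sub_one hη
  refine (h1.mul hη h3).mono ?_
  rw [abs_neg, abs_of_nonneg hx, mul_comm x]

theorem exists_hasDoubleSeries :
    ∃ η > 0, η ≤ 1 / 8 ∧ HasDoubleSeries η invDisc 2 ∧ ∀ x, 0 ≤ x →
      HasDoubleSeries η (fun A B => invDisc A B * Real.exp (-x * slowRoot A B))
        (2 * Real.exp (-x / 2)) ∧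
      HasDoubleSeries η (fun A B => invDisc A B * Real.exp (-x * fastRoot A B))
        (2 * Real.exp (-x / 2)) ∧
      HasDoubleSeries η (fun A B => slowRoot A B * invDisc A B * Real.exp (-x * fastRoot A B))
        (2 * Real.exp (-x / 2)) ∧
      HasDoubleSeries η (fun A B => fastRoot A B * invDisc A B * Real.exp (-x * slowRoot A B))
        (2 * Real.exp (-x / 2)) ∧
      HasDoubleSeries η (fun A B => invDisc A B * (Real.exp (-x * slowRoot A B) - 1))
        (2 * (Real.exp (2 * x) - 1)) := by
  have h := (isUnital_invDisc.eventually_hasDoubleSeries).and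
    ((isUnital_invDisc.eventually_mul_exp isUnital_slowRoot).and
    ((isUnital_invDisc.eventually_mul_exp isUnital_fastRoot).and
    (((isUnital_slowRoot.mul isUnital_invDisc).eventually_mul_exp isUnital_fastRoot).and
    (((isUnital_fastRoot.mul isUnital_invDisc).eventually_mul_exp isUnital_slowRoot).and
    (isUnital_invDisc.eventually_mul_exp_sub_one isUnital_slowRoot)))))
  obtain ⟨η, ⟨h1, h2, h3, h4, h5, h6⟩, hη⟩ :=
    (h.and (Ioc_mem_nhdsGT (show (0 : ℝ) < 1 / 8 by norm_num))).exists
  exact ⟨η, hη.1, hη.2, h1, fun x hx =>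
    ⟨h2 x hx, h3 x hx, h4 x hx, h5 x hx, h6 x hx⟩⟩

/-- The discriminant is positive because `(7/8)^2 > 4 · (1/8)`; this is the purpose of the
requirement `η ≤ 1/8`. -/
theorem disc_pos {A B : ℝ} (hA : |A| ≤ 1 / 8) (hB : |B| ≤ 1 / 8) :
    0 < 1 + A ∧ 0 < 1 - 4 * B * (1 + A)⁻¹ ^ 2 := by
  rw [abs_le] at hA hB
  have h1 : 0 < 1 + A := by linarith
  refine ⟨h1, ?_⟩
  have h2 : 1 - 4 * B * (1 + A)⁻¹ ^ 2 = ((1 + A) ^ 2 - 4 * B) / (1 + A) ^ 2 := by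
    field_simp
  rw [h2]
  apply div_pos _ (by positivity)
  nlinarith

/-! ### The roots and kernels in the scaled variables -/

section Roots

variable {σ σ₁ σ₂ r : ℝ}

theorem rpow_two_mul_sub (hr : 0 < r) :
    r ^ (2 * σ₂) = r ^ (2 * σ₁) * r ^ (2 * (σ₂ - σ₁)) ∧
    r ^ (2 * σ) = (r ^ (2 * σ₁)) ^ 2 * r ^ (2 * (σ - 2 * σ₁)) ∧
    r ^ (2 * (σ - σ₁)) = r ^ (2 * σ₁) * r ^ (2 * (σ - 2 * σ₁)) := by
  refine ⟨?_, ?_, ?_⟩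
  · rw [← Real.rpow_add hr]
    congr 1
    ring
  · rw [sq, ← Real.rpow_add hr, ← Real.rpow_add hr]
    congr 1
    ring
  · rw [← Real.rpow_add hr]
    congr 1
    ring

variable (a b : ℝ)

theorem Gam2_eq : Gam2 σ σ₁ σ₂ r a b =
    rootDisc (r ^ (2 * (σ₂ - σ₁)) * a) (r ^ (2 * (σ - 2 * σ₁)) * b) := by
  rw [Gam2, rootDisc, Gam1, mul_comm a, mul_assoc 4 b, mul_comm b]

theorem lam1_eq (hr : 0 < r) : lam1 σ σ₁ σ₂ r a b =
    -(r ^ (2 * σ₁) * r ^ (2 * (σ - 2 * σ₁))) *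
      slowRoot (r ^ (2 * (σ₂ - σ₁)) * a) (r ^ (2 * (σ - 2 * σ₁)) * b) := by
  rw [lam1, Gam2_eq, Gam1, mul_comm a, (rpow_two_mul_sub (σ₂ := σ₂) hr).2.2, slowRoot]
  ring

theorem Gdisc_eq (hr : 0 < r) (hA : 0 < 1 + r ^ (2 * (σ₂ - σ₁)) * a) :
    Gdisc σ σ₁ σ₂ r a b = r ^ (2 * σ₁) * ((1 + r ^ (2 * (σ₂ - σ₁)) * a) *
      rootDisc (r ^ (2 * (σ₂ - σ₁)) * a) (r ^ (2 * (σ - 2 * σ₁)) * b)) := by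
  rw [Gdisc, rootDisc, ← mul_assoc]
  obtain ⟨h1, h2, -⟩ := rpow_two_mul_sub (σ := σ) (σ₁ := σ₁) (σ₂ := σ₂) hr
  rw [h1, h2]
  have hP : 0 < r ^ (2 * σ₁) := Real.rpow_pos_of_pos hr _
  generalize r ^ (2 * σ₁) = P at *
  generalize r ^ (2 * (σ₂ - σ₁)) = p at *
  generalize r ^ (2 * (σ - 2 * σ₁)) = q at *
  rw [← Real.sqrt_sq (show 0 ≤ P * (1 + p * a) by positivity), ← Real.sqrt_mul (sq_nonneg _)]
  congr 1
  rw [show P + a * (P * p) = P * (1 + p * a) by ring]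
  generalize 1 + p * a = u at *
  field_simp

theorem lam2_eq (hr : 0 < r) (hA : 0 < 1 + r ^ (2 * (σ₂ - σ₁)) * a) :
    lam2 σ σ₁ σ₂ r a b = -r ^ (2 * σ₁) *
      fastRoot (r ^ (2 * (σ₂ - σ₁)) * a) (r ^ (2 * (σ - 2 * σ₁)) * b) := by
  rw [lam2, Gdisc_eq a b hr hA, (rpow_two_mul_sub (σ := σ) (σ₁ := σ₁) (σ₂ := σ₂) hr).1, fastRoot]
  ring

theorem inv_Gdisc_eq (hr : 0 < r) (hA : 0 < 1 + r ^ (2 * (σ₂ - σ₁)) * a) :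
    (Gdisc σ σ₁ σ₂ r a b)⁻¹ = (r ^ (2 * σ₁))⁻¹ *
      invDisc (r ^ (2 * (σ₂ - σ₁)) * a) (r ^ (2 * (σ - 2 * σ₁)) * b) := by
  rw [Gdisc_eq a b hr hA, invDisc, mul_inv, mul_inv]

variable (t : ℝ)

theorem K11_eq (hr : 0 < r) (hA : 0 < 1 + r ^ (2 * (σ₂ - σ₁)) * a) :
    K11 σ σ₁ σ₂ t r a b = (r ^ (2 * σ₁))⁻¹ *
      (invDisc (r ^ (2 * (σ₂ - σ₁)) * a) (r ^ (2 * (σ - 2 * σ₁)) * b) *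
        Real.exp (-(r ^ (2 * σ₁) * r ^ (2 * (σ - 2 * σ₁)) * t) *
          slowRoot (r ^ (2 * (σ₂ - σ₁)) * a) (r ^ (2 * (σ - 2 * σ₁)) * b))) := by
  rw [K11, inv_Gdisc_eq a b hr hA, lam1_eq a b hr, mul_assoc]
  congr 3
  ring

theorem K12_eq (hr : 0 < r) (hA : 0 < 1 + r ^ (2 * (σ₂ - σ₁)) * a) :
    K12 σ σ₁ σ₂ t r a b = (r ^ (2 * σ₁))⁻¹ *
      (invDisc (r ^ (2 * (σ₂ - σ₁)) * a) (r ^ (2 * (σ - 2 * σ₁)) * b) *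
        Real.exp (-(r ^ (2 * σ₁) * t) *
          fastRoot (r ^ (2 * (σ₂ - σ₁)) * a) (r ^ (2 * (σ - 2 * σ₁)) * b))) := by
  rw [K12, inv_Gdisc_eq a b hr hA, lam2_eq a b hr hA, mul_assoc]
  congr 3
  ring

theorem K01_eq (hr : 0 < r) (hA : 0 < 1 + r ^ (2 * (σ₂ - σ₁)) * a) :
    K01 σ σ₁ σ₂ t r a b = -r ^ (2 * (σ - 2 * σ₁)) *
      (slowRoot (r ^ (2 * (σ₂ - σ₁)) * a) (r ^ (2 * (σ - 2 * σ₁)) * b) *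
        invDisc (r ^ (2 * (σ₂ - σ₁)) * a) (r ^ (2 * (σ - 2 * σ₁)) * b) *
        Real.exp (-(r ^ (2 * σ₁) * t) *
          fastRoot (r ^ (2 * (σ₂ - σ₁)) * a) (r ^ (2 * (σ - 2 * σ₁)) * b))) := by
  have hP : 0 < r ^ (2 * σ₁) := Real.rpow_pos_of_pos hr _
  rw [K01, inv_Gdisc_eq a b hr hA, lam2_eq a b hr hA, lam1_eq a b hr]
  rw [show ∀ X S : ℝ, -X * S * t = -(X * t) * S by intros; ring]
  field_simp

theorem K02_eq (hr : 0 < r) (hA : 0 < 1 + r ^ (2 * (σ₂ - σ₁)) * a) :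
    K02 σ σ₁ σ₂ t r a b = -1 *
      (fastRoot (r ^ (2 * (σ₂ - σ₁)) * a) (r ^ (2 * (σ - 2 * σ₁)) * b) *
        invDisc (r ^ (2 * (σ₂ - σ₁)) * a) (r ^ (2 * (σ - 2 * σ₁)) * b) *
        Real.exp (-(r ^ (2 * σ₁) * r ^ (2 * (σ - 2 * σ₁)) * t) *
          slowRoot (r ^ (2 * (σ₂ - σ₁)) * a) (r ^ (2 * (σ - 2 * σ₁)) * b))) := by
  have hP : 0 < r ^ (2 * σ₁) := Real.rpow_pos_of_pos hr _
  rw [K02, inv_Gdisc_eq a b hr hA, lam2_eq a b hr hA, lam1_eq a b hr]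
  rw [show ∀ X Y S : ℝ, -(X * Y) * S * t = -(X * Y * t) * S by intros; ring]
  field_simp

/-- The characteristic roots of the equation at a frequency at which they are real. -/
theorem lam_add_mul_sub (hr : 0 < r)
    (hD : 0 < 1 - 4 * r ^ (2 * (σ - 2 * σ₁)) * (1 + r ^ (2 * (σ₂ - σ₁)))⁻¹ ^ 2) :
    lam1 σ σ₁ σ₂ r 1 1 + lam2 σ σ₁ σ₂ r 1 1 = -(r ^ (2 * σ₁) + r ^ (2 * σ₂)) ∧
    lam1 σ σ₁ σ₂ r 1 1 * lam2 σ σ₁ σ₂ r 1 1 = r ^ (2 * σ) ∧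
    lam1 σ σ₁ σ₂ r 1 1 - lam2 σ σ₁ σ₂ r 1 1 = Gdisc σ σ₁ σ₂ r 1 1 ∧
    0 < Gdisc σ σ₁ σ₂ r 1 1 := by
  have hp : 0 < r ^ (2 * (σ₂ - σ₁)) := Real.rpow_pos_of_pos hr _
  have hP : 0 < r ^ (2 * σ₁) := Real.rpow_pos_of_pos hr _
  have hA : 0 < 1 + r ^ (2 * (σ₂ - σ₁)) * 1 := by linarith
  obtain ⟨h1, h2, -⟩ := rpow_two_mul_sub (σ := σ) (σ₁ := σ₁) (σ₂ := σ₂) hr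
  rw [Gdisc_eq 1 1 hr hA, lam1_eq 1 1 hr, lam2_eq 1 1 hr hA, h1, h2, slowRoot, fastRoot]
  simp only [mul_one]
  set R := rootDisc (r ^ (2 * (σ₂ - σ₁))) (r ^ (2 * (σ - 2 * σ₁))) with hR
  have hR0 : 0 < R := Real.sqrt_pos.2 hD
  have hR2 : R ^ 2 = 1 - 4 * r ^ (2 * (σ - 2 * σ₁)) * (1 + r ^ (2 * (σ₂ - σ₁)))⁻¹ ^ 2 :=
    Real.sq_sqrt hD.le
  clear_value R
  generalize r ^ (2 * σ₁) = P at *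
  generalize r ^ (2 * (σ₂ - σ₁)) = p at *
  generalize r ^ (2 * (σ - 2 * σ₁)) = q at *
  -- Eliminating `q` in favour of the root `R` turns the claims into identities of rational
  -- functions.
  have hq : q = (1 - R ^ 2) * (1 + p) ^ 2 / 4 := by
    rw [hR2]
    field_simp
    ring
  rw [hq]
  refine ⟨?_, ?_, ?_, by positivity⟩
  · field_simp
    ring
  · field_simp
  · field_simp
    ring

end Roots

/-! ### Bounds for the profiles and their errors at one frequency -/

/-- A polyradius on which all the profiles are given by double power series. -/
def IsGoodRadius (η : ℝ) : Prop :=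
  0 < η ∧ η ≤ 1 / 8 ∧ HasDoubleSeries η invDisc 2 ∧ ∀ x, 0 ≤ x →
    HasDoubleSeries η (fun A B => invDisc A B * Real.exp (-x * slowRoot A B))
      (2 * Real.exp (-x / 2)) ∧
    HasDoubleSeries η (fun A B => invDisc A B * Real.exp (-x * fastRoot A B))
      (2 * Real.exp (-x / 2)) ∧
    HasDoubleSeries η (fun A B => slowRoot A B * invDisc A B * Real.exp (-x * fastRoot A B))
      (2 * Real.exp (-x / 2)) ∧
    HasDoubleSeries η (fun A B => fastRoot A B * invDisc A B * Real.exp (-x * slowRoot A B))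
      (2 * Real.exp (-x / 2)) ∧
    HasDoubleSeries η (fun A B => invDisc A B * (Real.exp (-x * slowRoot A B) - 1))
      (2 * (Real.exp (2 * x) - 1))

section Profiles

variable {σ σ₁ σ₂ r η t θ : ℝ}

/-- The fundamental solution of the Fourier transformed problem for the data `(1, 0)`. -/
def E0 (σ σ₁ σ₂ t r : ℝ) : ℝ := K01 σ σ₁ σ₂ t r 1 1 - K02 σ σ₁ σ₂ t r 1 1

/-- The fundamental solution of the Fourier transformed problem for the data `(0, 1)`. -/
def E1 (σ σ₁ σ₂ t r : ℝ) : ℝ := K11 σ σ₁ σ₂ t r 1 1 - K12 σ σ₁ σ₂ t r 1 1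

theorem one_add_pos_of_abs_le {x : ℝ} (hη : IsGoodRadius η) (hx : |x| ≤ η) : 0 < 1 + x := by
  have := (abs_le.1 (hx.trans hη.2.1)).1
  linarith

theorem abs_A1_le (hη : IsGoodRadius η) (hr : 0 < r) (ht : 0 ≤ t) (hθ : 1 ≤ θ)
    (hp : r ^ (2 * (σ₂ - σ₁)) ≤ θ * η) (hq : r ^ (2 * (σ - 2 * σ₁)) ≤ θ * η) (k : ℕ) :
    |A1 σ σ₁ σ₂ k t r| ≤ (r ^ (2 * σ₁))⁻¹ * (θ ^ k * (2 *
      (Real.exp (-(r ^ (2 * σ₁) * r ^ (2 * (σ - 2 * σ₁)) * t) / 2) +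
        Real.exp (-(r ^ (2 * σ₁) * t) / 2)))) := by
  have hP : 0 < r ^ (2 * σ₁) := Real.rpow_pos_of_pos hr _
  have hp0 : 0 < r ^ (2 * (σ₂ - σ₁)) := Real.rpow_pos_of_pos hr _
  have hq0 : 0 < r ^ (2 * (σ - 2 * σ₁)) := Real.rpow_pos_of_pos hr _
  rw [← abs_of_pos hp0] at hp
  rw [← abs_of_pos hq0] at hq
  have h1 := (hη.2.2.2 (r ^ (2 * σ₁) * r ^ (2 * (σ - 2 * σ₁)) * t) (by positivity)).1
    |>.abs_taylorSum_le hη.1 (fun a b ha _ =>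
      K11_eq (σ := σ) a b t hr (one_add_pos_of_abs_le hη ha)) hθ hp hq k
  have h2 := (hη.2.2.2 (r ^ (2 * σ₁) * t) (by positivity)).2.1
    |>.abs_taylorSum_le hη.1 (fun a b ha _ =>
      K12_eq (σ := σ) a b t hr (one_add_pos_of_abs_le hη ha)) hθ hp hq k
  rw [abs_of_pos (inv_pos.2 hP)] at h1 h2
  rw [A1]
  refine (abs_sub _ _).trans ((add_le_add h1 h2).trans (le_of_eq ?_))
  ring

theorem abs_A0_le (hη : IsGoodRadius η) (hr : 0 < r) (ht : 0 ≤ t) (hθ : 1 ≤ θ)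
    (hp : r ^ (2 * (σ₂ - σ₁)) ≤ θ * η) (hq : r ^ (2 * (σ - 2 * σ₁)) ≤ θ * η) (k : ℕ) :
    |A0 σ σ₁ σ₂ k t r| ≤ (r ^ (2 * (σ - 2 * σ₁)) + 1) * (θ ^ k * (2 *
      (Real.exp (-(r ^ (2 * σ₁) * r ^ (2 * (σ - 2 * σ₁)) * t) / 2) +
        Real.exp (-(r ^ (2 * σ₁) * t) / 2)))) := by
  have hP : 0 < r ^ (2 * σ₁) := Real.rpow_pos_of_pos hr _
  have hp0 : 0 < r ^ (2 * (σ₂ - σ₁)) := Real.rpow_pos_of_pos hr _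
  have hq0 : 0 < r ^ (2 * (σ - 2 * σ₁)) := Real.rpow_pos_of_pos hr _
  rw [← abs_of_pos hp0] at hp
  have hq' := hq
  rw [← abs_of_pos hq0] at hq'
  have h1 := (hη.2.2.2 (r ^ (2 * σ₁) * t) (by positivity)).2.2.1
    |>.abs_taylorSum_le hη.1 (fun a b ha _ =>
      K01_eq (σ := σ) a b t hr (one_add_pos_of_abs_le hη ha)) hθ hp hq' k
  have h2 := (hη.2.2.2 (r ^ (2 * σ₁) * r ^ (2 * (σ - 2 * σ₁)) * t) (by positivity)).2.2.2.1
    |>.abs_taylorSum_le hη.1 (fun a b ha _ =>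
      K02_eq (σ := σ) a b t hr (one_add_pos_of_abs_le hη ha)) hθ hp hq' k
  rw [abs_neg, abs_of_pos hq0] at h1
  rw [abs_neg, abs_one, one_mul] at h2
  rw [A0]
  refine (abs_sub _ _).trans ((add_le_add h1 h2).trans ?_)
  have hx := Real.exp_pos (-(r ^ (2 * σ₁) * r ^ (2 * (σ - 2 * σ₁)) * t) / 2)
  have hy := Real.exp_pos (-(r ^ (2 * σ₁) * t) / 2)
  generalize Real.exp (-(r ^ (2 * σ₁) * r ^ (2 * (σ - 2 * σ₁)) * t) / 2) = X at *
  generalize Real.exp (-(r ^ (2 * σ₁) * t) / 2) = Y at *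
  have hθk : 0 < θ ^ k := by positivity
  have e1 : (r ^ (2 * (σ - 2 * σ₁)) + 1) * (θ ^ k * (2 * (X + Y))) =
      r ^ (2 * (σ - 2 * σ₁)) * (θ ^ k * (2 * Y)) + θ ^ k * (2 * X) +
      (r ^ (2 * (σ - 2 * σ₁)) * (θ ^ k * (2 * X)) + θ ^ k * (2 * Y)) := by ring
  rw [e1]
  exact le_add_of_nonneg_right (by positivity)

theorem abs_E1_sub_A1_le (hη : IsGoodRadius η) (hr : 0 < r) (ht : 0 ≤ t) (hθ0 : 0 ≤ θ)
    (hθ : θ ≤ 1)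
    (hp : r ^ (2 * (σ₂ - σ₁)) ≤ θ * η) (hq : r ^ (2 * (σ - 2 * σ₁)) ≤ θ * η) (k : ℕ) :
    |E1 σ σ₁ σ₂ t r - A1 σ σ₁ σ₂ k t r| ≤ (r ^ (2 * σ₁))⁻¹ * (θ ^ k * (2 *
      (Real.exp (-(r ^ (2 * σ₁) * r ^ (2 * (σ - 2 * σ₁)) * t) / 2) +
        Real.exp (-(r ^ (2 * σ₁) * t) / 2)))) := by
  have hP : 0 < r ^ (2 * σ₁) := Real.rpow_pos_of_pos hr _
  have hp0 : 0 < r ^ (2 * (σ₂ - σ₁)) := Real.rpow_pos_of_pos hr _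
  have hq0 : 0 < r ^ (2 * (σ - 2 * σ₁)) := Real.rpow_pos_of_pos hr _
  rw [← abs_of_pos hp0] at hp
  rw [← abs_of_pos hq0] at hq
  have h1 := (hη.2.2.2 (r ^ (2 * σ₁) * r ^ (2 * (σ - 2 * σ₁)) * t) (by positivity)).1
    |>.abs_sub_taylorSum_le hη.1 (fun a b ha _ =>
      K11_eq (σ := σ) a b t hr (one_add_pos_of_abs_le hη ha)) hθ0 hθ hp hq k
  have h2 := (hη.2.2.2 (r ^ (2 * σ₁) * t) (by positivity)).2.1
    |>.abs_sub_taylorSum_le hη.1 (fun a b ha _ =>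
      K12_eq (σ := σ) a b t hr (one_add_pos_of_abs_le hη ha)) hθ0 hθ hp hq k
  rw [abs_of_pos (inv_pos.2 hP)] at h1 h2
  rw [E1, A1, K11_eq 1 1 t hr (by linarith), K12_eq 1 1 t hr (by linarith), mul_one, mul_one,
    sub_sub_sub_comm]
  refine (abs_sub _ _).trans ((add_le_add h1 h2).trans (le_of_eq ?_))
  ring

theorem abs_E0_sub_A0_le (hη : IsGoodRadius η) (hr : 0 < r) (ht : 0 ≤ t) (hθ0 : 0 ≤ θ)
    (hθ : θ ≤ 1)
    (hp : r ^ (2 * (σ₂ - σ₁)) ≤ θ * η) (hq : r ^ (2 * (σ - 2 * σ₁)) ≤ θ * η) (k : ℕ) :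
    |E0 σ σ₁ σ₂ t r - A0 σ σ₁ σ₂ k t r| ≤ θ ^ k * (2 *
      (Real.exp (-(r ^ (2 * σ₁) * r ^ (2 * (σ - 2 * σ₁)) * t) / 2) +
        Real.exp (-(r ^ (2 * σ₁) * t) / 2))) := by
  have hP : 0 < r ^ (2 * σ₁) := Real.rpow_pos_of_pos hr _
  have hp0 : 0 < r ^ (2 * (σ₂ - σ₁)) := Real.rpow_pos_of_pos hr _
  have hq0 : 0 < r ^ (2 * (σ - 2 * σ₁)) := Real.rpow_pos_of_pos hr _
  have hq1 : r ^ (2 * (σ - 2 * σ₁)) ≤ 1 := by nlinarith [hη.1, hη.2.1]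
  rw [← abs_of_pos hp0] at hp
  rw [← abs_of_pos hq0] at hq
  have h1 := (hη.2.2.2 (r ^ (2 * σ₁) * t) (by positivity)).2.2.1
    |>.abs_sub_taylorSum_le hη.1 (fun a b ha _ =>
      K01_eq (σ := σ) a b t hr (one_add_pos_of_abs_le hη ha)) hθ0 hθ hp hq k
  have h2 := (hη.2.2.2 (r ^ (2 * σ₁) * r ^ (2 * (σ - 2 * σ₁)) * t) (by positivity)).2.2.2.1
    |>.abs_sub_taylorSum_le hη.1 (fun a b ha _ =>
      K02_eq (σ := σ) a b t hr (one_add_pos_of_abs_le hη ha)) hθ0 hθ hp hq k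
  rw [abs_neg, abs_of_pos hq0] at h1
  rw [abs_neg, abs_one, one_mul] at h2
  rw [E0, A0, K01_eq 1 1 t hr (by linarith), K02_eq 1 1 t hr (by linarith), mul_one, mul_one,
    sub_sub_sub_comm]
  have h3 := h1.trans (mul_le_of_le_one_left (by positivity) hq1)
  refine (abs_sub _ _).trans ((add_le_add h3 h2).trans (le_of_eq ?_))
  ring

/-- With `exp(-x slowRoot) = 1 + (exp(-x slowRoot) - 1)`, the term 1 leaves the remainder of
`invDisc`, which is free of `t`. The two subtracted terms bound the remainders of the correction,
small when `x = r^{2(σ-σ₁)} t` is small, and of the fast kernel, small when `r^{2σ₁} t` is large. -/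
theorem le_abs_E1_sub_A1 (hη : IsGoodRadius η) (hr : 0 < r) (ht : 0 ≤ t) (hθ0 : 0 ≤ θ)
    (hθ : θ ≤ 1)
    (hp : r ^ (2 * (σ₂ - σ₁)) ≤ θ * η) (hq : r ^ (2 * (σ - 2 * σ₁)) ≤ θ * η) (k : ℕ) :
    (r ^ (2 * σ₁))⁻¹ * (|invDisc (r ^ (2 * (σ₂ - σ₁))) (r ^ (2 * (σ - 2 * σ₁))) -
        taylorSum (fun a b => invDisc (r ^ (2 * (σ₂ - σ₁)) * a)
          (r ^ (2 * (σ - 2 * σ₁)) * b)) k| -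
      θ ^ k * (2 * (Real.exp (2 * (r ^ (2 * σ₁) * r ^ (2 * (σ - 2 * σ₁)) * t)) - 1)) -
      θ ^ k * (2 * Real.exp (-(r ^ (2 * σ₁) * t) / 2))) ≤
    |E1 σ σ₁ σ₂ t r - A1 σ σ₁ σ₂ k t r| := by
  have hP : 0 < r ^ (2 * σ₁) := Real.rpow_pos_of_pos hr _
  have hp0 : 0 < r ^ (2 * (σ₂ - σ₁)) := Real.rpow_pos_of_pos hr _
  have hq0 : 0 < r ^ (2 * (σ - 2 * σ₁)) := Real.rpow_pos_of_pos hr _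
  rw [← abs_of_pos hp0] at hp
  rw [← abs_of_pos hq0] at hq
  have hS := (hη.2.2.2 (r ^ (2 * σ₁) * r ^ (2 * (σ - 2 * σ₁)) * t) (by positivity)).2.2.2.2
  have h0 := hη.2.2.1.taylorSum_add hη.1 hS (G := K11 σ σ₁ σ₂ t r) (κ := (r ^ (2 * σ₁))⁻¹)
    (p := r ^ (2 * (σ₂ - σ₁))) (q := r ^ (2 * (σ - 2 * σ₁))) (fun a b ha _ => by
      rw [K11_eq (σ := σ) a b t hr (one_add_pos_of_abs_le hη ha)]
      ring) k
  have h1 := hS.abs_sub_taylorSum_le hη.1 (κ := 1) (fun a b _ _ => (one_mul _).symm)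
    hθ0 hθ hp hq k
  have h2 := (hη.2.2.2 (r ^ (2 * σ₁) * t) (by positivity)).2.1
    |>.abs_sub_taylorSum_le hη.1 (fun a b ha _ =>
      K12_eq (σ := σ) a b t hr (one_add_pos_of_abs_le hη ha)) hθ0 hθ hp hq k
  rw [abs_of_pos (inv_pos.2 hP)] at h2
  rw [abs_one, one_mul, one_mul] at h1
  rw [E1, A1, K11_eq 1 1 t hr (by linarith), K12_eq 1 1 t hr (by linarith), mul_one, mul_one,
    sub_sub_sub_comm, h0]
  set p := r ^ (2 * (σ₂ - σ₁))
  set q := r ^ (2 * (σ - 2 * σ₁))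
  set P := r ^ (2 * σ₁)
  set T₀ := taylorSum (fun a b => invDisc (p * a) (q * b)) k
  set T₁ := taylorSum (fun a b => invDisc (p * a) (q * b) *
    (Real.exp (-(P * q * t) * slowRoot (p * a) (q * b)) - 1)) k
  set R₁ := invDisc p q * (Real.exp (-(P * q * t) * slowRoot p q) - 1) - T₁ with hR₁
  set R₂ := P⁻¹ * (invDisc p q * Real.exp (-(P * t) * fastRoot p q)) -
    taylorSum (K12 σ σ₁ σ₂ t r) k
  have e1 : P⁻¹ * (invDisc p q * Real.exp (-(P * q * t) * slowRoot p q)) - P⁻¹ * (T₀ + T₁) =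
      P⁻¹ * ((invDisc p q - T₀) + R₁) := by
    rw [hR₁]
    ring
  rw [e1]
  have h3 := abs_sub_abs_le_abs_sub (P⁻¹ * ((invDisc p q - T₀) + R₁)) R₂
  have h4 : |invDisc p q - T₀| - |R₁| ≤ |(invDisc p q - T₀) + R₁| := by
    have := abs_sub_abs_le_abs_sub (invDisc p q - T₀) (-R₁)
    rwa [abs_neg, sub_neg_eq_add] at this
  rw [abs_mul, abs_of_pos (inv_pos.2 hP)] at h3
  have h5 := mul_le_mul_of_nonneg_left (h4.trans' (sub_le_sub_left h1 _)) (inv_pos.2 hP).le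
  rw [mul_sub]
  linarith

end Profiles

/-! ### The ordinary differential equation at one frequency -/

section Ode

/-- Decay of the energy `w² + (b + a² / 2) v² + a v w` for the equation `v'' + a v' + b v = 0`. -/
theorem energy_le {a b κ : ℝ} {v w : ℝ → ℝ}
    (hκ : ∀ x y : ℝ, κ * (y ^ 2 + (b + a ^ 2 / 2) * x ^ 2 + a * (x * y)) ≤
      a * y ^ 2 + a * b * x ^ 2)
    (h : ∀ t, 0 ≤ t → HasDerivWithinAt v (w t) (Set.Ici 0) t ∧
      HasDerivWithinAt w (-(b * v t + a * w t)) (Set.Ici 0) t) {t : ℝ} (ht : 0 ≤ t) :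
    w t ^ 2 + (b + a ^ 2 / 2) * v t ^ 2 + a * (v t * w t) ≤
      Real.exp (-κ * t) * (w 0 ^ 2 + (b + a ^ 2 / 2) * v 0 ^ 2 + a * (v 0 * w 0)) := by
  -- The coefficient `b + a² / 2` makes the products `v w` cancel in the derivative of the energy,
  -- which is `-(a w² + a b v²)`; `hκ` compares this with `κ` times the energy.
  have hd : ∀ t, 0 ≤ t → HasDerivWithinAt
      (fun t => Real.exp (κ * t) * (w t ^ 2 + (b + a ^ 2 / 2) * v t ^ 2 + a * (v t * w t)))
      (Real.exp (κ * t) * (κ * (w t ^ 2 + (b + a ^ 2 / 2) * v t ^ 2 + a * (v t * w t)) -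
        (a * w t ^ 2 + a * b * v t ^ 2))) (Set.Ici 0) t := by
    intro t ht
    obtain ⟨hv, hw⟩ := h t ht
    have he : HasDerivWithinAt (fun t => Real.exp (κ * t)) (Real.exp (κ * t) * κ) (Set.Ici 0) t := by
      simpa using (((hasDerivAt_id t).const_mul κ).exp).hasDerivWithinAt
    refine (he.mul (((hw.pow 2).add ((hv.pow 2).const_mul (b + a ^ 2 / 2))).add
      ((hv.mul hw).const_mul a))).congr_deriv ?_
    simp only [Pi.add_apply, Pi.mul_apply, Pi.pow_apply]
    ring
  have hanti := antitoneOn_of_hasDerivWithinAt_nonpos (convex_Ici (0 : ℝ))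
    (fun t ht => (hd t ht).continuousWithinAt)
    (fun t ht => (hd t (interior_subset ht)).mono interior_subset)
    (fun t _ => mul_nonpos_of_nonneg_of_nonpos (Real.exp_pos _).le (by linarith [hκ (v t) (w t)]))
  have h1 := hanti (Set.self_mem_Ici) (Set.mem_Ici.2 ht) ht
  simp only [mul_zero, Real.exp_zero, one_mul] at h1
  rw [neg_mul, Real.exp_neg, ← div_eq_inv_mul, le_div_iff₀ (Real.exp_pos _), mul_comm]
  exact h1

theorem sq_le_of_ode_real {a b κ : ℝ} {v w : ℝ → ℝ} (hb : 0 ≤ b)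
    (hκ : ∀ x y : ℝ, κ * (y ^ 2 + (b + a ^ 2 / 2) * x ^ 2 + a * (x * y)) ≤
      a * y ^ 2 + a * b * x ^ 2)
    (h : ∀ t, 0 ≤ t → HasDerivWithinAt v (w t) (Set.Ici 0) t ∧
      HasDerivWithinAt w (-(b * v t + a * w t)) (Set.Ici 0) t) {t : ℝ} (ht : 0 ≤ t) :
    a ^ 2 * v t ^ 2 ≤
      6 * Real.exp (-κ * t) * (3 / 2 * w 0 ^ 2 + (b + a ^ 2) * v 0 ^ 2) := by
  have h1 := energy_le hκ h ht
  -- The energy equals `(w + a v / 2)² + (b + a² / 4) v²`, so the constant 6 leaves some room.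
  have h2 : a ^ 2 * v t ^ 2 / 6 ≤ w t ^ 2 + (b + a ^ 2 / 2) * v t ^ 2 + a * (v t * w t) := by
    nlinarith [sq_nonneg (3 / 4 * w t + 2 / 3 * (a * v t)), mul_nonneg hb (sq_nonneg (v t)),
      sq_nonneg (w t + 1 / 2 * (a * v t)), sq_nonneg (a * v t), sq_nonneg (w t)]
  have h3 : w 0 ^ 2 + (b + a ^ 2 / 2) * v 0 ^ 2 + a * (v 0 * w 0) ≤
      3 / 2 * w 0 ^ 2 + (b + a ^ 2) * v 0 ^ 2 := by
    nlinarith [sq_nonneg (w 0 - a * v 0)]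
  have h4 := mul_le_mul_of_nonneg_left h3 (Real.exp_pos (-κ * t)).le
  linarith

theorem sq_norm_le_of_ode {a b κ : ℝ} {v w : ℝ → ℂ} (hb : 0 ≤ b)
    (hκ : ∀ x y : ℝ, κ * (y ^ 2 + (b + a ^ 2 / 2) * x ^ 2 + a * (x * y)) ≤
      a * y ^ 2 + a * b * x ^ 2)
    (h : ∀ t, 0 ≤ t → HasDerivWithinAt v (w t) (Set.Ici 0) t ∧
      HasDerivWithinAt w (-((b : ℂ) * v t + (a : ℂ) * w t)) (Set.Ici 0) t) {t : ℝ} (ht : 0 ≤ t) :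
    a ^ 2 * ‖v t‖ ^ 2 ≤
      6 * Real.exp (-κ * t) * (3 / 2 * ‖w 0‖ ^ 2 + (b + a ^ 2) * ‖v 0‖ ^ 2) := by
  have hre := sq_le_of_ode_real (v := fun t => (v t).re) (w := fun t => (w t).re) hb hκ
    (fun t ht => ⟨Complex.reCLM.hasFDerivAt.comp_hasDerivWithinAt t (h t ht).1, 
      (Complex.reCLM.hasFDerivAt.comp_hasDerivWithinAt t (h t ht).2).congr_deriv (by simp)⟩) ht
  have him := sq_le_of_ode_real (v := fun t => (v t).im) (w := fun t => (w t).im) hb hκ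
    (fun t ht => ⟨Complex.imCLM.hasFDerivAt.comp_hasDerivWithinAt t (h t ht).1, 
      (Complex.imCLM.hasFDerivAt.comp_hasDerivWithinAt t (h t ht).2).congr_deriv (by simp)⟩) ht
  have hn : ∀ z : ℂ, ‖z‖ ^ 2 = z.re ^ 2 + z.im ^ 2 := fun z => by
    rw [Complex.sq_norm, Complex.normSq_apply]
    ring
  rw [hn, hn, hn]
  linarith

/-- The equation satisfied by the Fourier transform of a solution at the frequency `r`. -/
def SolvesOde (σ σ₁ σ₂ r : ℝ) (v w : ℝ → ℂ) : Prop :=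
  ∀ t, 0 ≤ t → HasDerivWithinAt v (w t) (Set.Ici 0) t ∧
    HasDerivWithinAt w (-(((r ^ (2 * σ) : ℝ) : ℂ) * v t +
      ((r ^ (2 * σ₁) + r ^ (2 * σ₂) : ℝ) : ℂ) * w t)) (Set.Ici 0) t

variable {σ σ₁ σ₂ r : ℝ} {v w : ℝ → ℂ}

/-- With `κ = 0` the energy is merely nonincreasing, which suffices for uniqueness. -/
theorem SolvesOde.eq_zero (hr : 0 < r) (h : SolvesOde σ σ₁ σ₂ r v w) (hv : v 0 = 0)
    (hw : w 0 = 0) {t : ℝ} (ht : 0 ≤ t) : v t = 0 := by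
  have ha : 0 < r ^ (2 * σ₁) + r ^ (2 * σ₂) := by positivity
  have hb : 0 < r ^ (2 * σ) := by positivity
  have h1 := sq_norm_le_of_ode (κ := 0) hb.le (fun x y => by rw [zero_mul]; positivity) h ht
  rw [hv, hw] at h1
  simp only [norm_zero, ne_eq, OfNat.ofNat_ne_zero, not_false_eq_true, zero_pow, mul_zero,
    add_zero] at h1
  have h2 : ‖v t‖ ^ 2 ≤ 0 := nonpos_of_mul_nonpos_right h1 (by positivity)
  simpa using h2

theorem SolvesOde.eq_explicit (hr : 0 < r)
    (hD : 0 < 1 - 4 * r ^ (2 * (σ - 2 * σ₁)) * (1 + r ^ (2 * (σ₂ - σ₁)))⁻¹ ^ 2)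
    (h : SolvesOde σ σ₁ σ₂ r v w) {t : ℝ} (ht : 0 ≤ t) :
    v t = (E0 σ σ₁ σ₂ t r : ℂ) * v 0 + (E1 σ σ₁ σ₂ t r : ℂ) * w 0 := by
  obtain ⟨h1, h2, h3, h4⟩ := lam_add_mul_sub (σ := σ) (σ₁ := σ₁) (σ₂ := σ₂) hr hD
  set L := lam1 σ σ₁ σ₂ r 1 1 with hL
  set N := lam2 σ σ₁ σ₂ r 1 1 with hN
  set G := Gdisc σ σ₁ σ₂ r 1 1 with hG
  have hexp : ∀ (c t : ℝ), HasDerivAt (fun t => Real.exp (c * t)) (c * Real.exp (c * t)) t := by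
    intro c t
    simpa [mul_comm] using ((hasDerivAt_id t).const_mul c).exp
  have d0 : ∀ t, HasDerivAt (fun t => E0 σ σ₁ σ₂ t r)
      (G⁻¹ * L * (N * Real.exp (N * t)) - G⁻¹ * N * (L * Real.exp (L * t))) t := fun t =>
    ((hexp N t).const_mul _).sub ((hexp L t).const_mul _)
  have d1 : ∀ t, HasDerivAt (fun t => E1 σ σ₁ σ₂ t r)
      (G⁻¹ * (L * Real.exp (L * t)) - G⁻¹ * (N * Real.exp (N * t))) t := fun t =>
    ((hexp L t).const_mul _).sub ((hexp N t).const_mul _)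
  have dd0 : ∀ t, HasDerivAt
      (fun t => G⁻¹ * L * (N * Real.exp (N * t)) - G⁻¹ * N * (L * Real.exp (L * t)))
      (G⁻¹ * L * (N * (N * Real.exp (N * t))) - G⁻¹ * N * (L * (L * Real.exp (L * t)))) t :=
    fun t => (((hexp N t).const_mul N).const_mul _).sub (((hexp L t).const_mul L).const_mul _)
  have dd1 : ∀ t, HasDerivAt
      (fun t => G⁻¹ * (L * Real.exp (L * t)) - G⁻¹ * (N * Real.exp (N * t)))
      (G⁻¹ * (L * (L * Real.exp (L * t))) - G⁻¹ * (N * (N * Real.exp (N * t)))) t :=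
    fun t => (((hexp L t).const_mul L).const_mul _).sub (((hexp N t).const_mul N).const_mul _)
  have hsol : SolvesOde σ σ₁ σ₂ r
      (fun t => v t - ((E0 σ σ₁ σ₂ t r : ℂ) * v 0 + (E1 σ σ₁ σ₂ t r : ℂ) * w 0))
      (fun t => w t -
        (((G⁻¹ * L * (N * Real.exp (N * t)) - G⁻¹ * N * (L * Real.exp (L * t)) : ℝ) : ℂ) * v 0 +
        ((G⁻¹ * (L * Real.exp (L * t)) - G⁻¹ * (N * Real.exp (N * t)) : ℝ) : ℂ) * w 0)) := by
    intro t ht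
    obtain ⟨hv, hw⟩ := h t ht
    refine ⟨hv.sub (((d0 t).ofReal_comp.mul_const (v 0)).add
      ((d1 t).ofReal_comp.mul_const (w 0))).hasDerivWithinAt, ?_⟩
    refine (hw.sub (((dd0 t).ofReal_comp.mul_const (v 0)).add
      ((dd1 t).ofReal_comp.mul_const (w 0))).hasDerivWithinAt).congr_deriv ?_
    beta_reduce
    rw [← h2, show r ^ (2 * σ₁) + r ^ (2 * σ₂) = -(L + N) by rw [h1, neg_neg], E0, E1, K01, K02,
      K11, K12, ← hL, ← hN, ← hG]
    push_cast
    ring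
  have hz := hsol.eq_zero hr ?_ ?_ ht
  · exact sub_eq_zero.1 hz
  · have e0 : E0 σ σ₁ σ₂ 0 r = 1 := by
      rw [E0, K01, K02, ← hL, ← hN, ← hG, mul_zero, mul_zero, Real.exp_zero, mul_one, mul_one,
        ← mul_sub, h3, inv_mul_cancel₀ h4.ne']
    have e1 : E1 σ σ₁ σ₂ 0 r = 0 := by
      rw [E1, K11, K12, mul_zero, mul_zero, sub_self]
    simp only [e0, e1]
    simp
  · have e0 : G⁻¹ * L * (N * Real.exp (N * 0)) - G⁻¹ * N * (L * Real.exp (L * 0)) = 0 := by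
      simp only [mul_zero, Real.exp_zero]
      ring
    have e1 : G⁻¹ * (L * Real.exp (L * 0)) - G⁻¹ * (N * Real.exp (N * 0)) = 1 := by
      simp only [mul_zero, Real.exp_zero, mul_one]
      rw [← mul_sub, h3, inv_mul_cancel₀ h4.ne']
    simp only [e0, e1]
    simp

/-- For `r ≥ ε` the damping `a = r^{2σ₁} + r^{2σ₂}` and the stiffness `b = r^{2σ}` satisfy `a₀ ≤ a`,
`b ≤ C₀ a²` and `c₀ a ≤ b`, so the energy decays at a rate independent of `r`. The second inequality
rests on `σ/2 < σ₂`, the third on `σ₂ ≤ σ`. The weight on `w 0` comes from dividing by `a ≥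
r^{2σ₂}`. -/
theorem exists_highFrequency_decay (hσ₁σ : σ₁ < σ) (hσσ₂ : σ / 2 < σ₂) (hσ₂ : σ₂ ≤ σ)
    {ε : ℝ} (hε : 0 < ε) :
    ∃ κ > 0, ∃ C > 0, ∀ r, ε ≤ r → ∀ v w, SolvesOde σ σ₁ σ₂ r v w → ∀ t, 0 ≤ t →
      ‖v t‖ ≤ C * Real.exp (-κ * t) * (‖v 0‖ + r ^ (-(2 * σ₂)) * ‖w 0‖) := by
  have hmono : ∀ {r x : ℝ}, ε ≤ r → x ≤ 0 → r ^ x ≤ ε ^ x := fun h1 h2 =>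
    Real.rpow_le_rpow_of_nonpos hε h1 h2
  set a₀ := ε ^ (2 * σ₂) with ha₀
  set C₀ := ε ^ (2 * σ - 4 * σ₂) with hC₀
  set c₀ := (ε ^ (2 * σ₁ - 2 * σ) + ε ^ (2 * σ₂ - 2 * σ))⁻¹ with hc₀
  have ha₀0 : 0 < a₀ := Real.rpow_pos_of_pos hε _
  have hC₀0 : 0 < C₀ := Real.rpow_pos_of_pos hε _
  have hc₀0 : 0 < c₀ := by positivity
  -- The energy is at most `3/2 y² + (C₀ + 1) a² x²`; the two entries of the minimum let `a y²` and
  -- `a b x²` dominate the corresponding terms.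
  set κ := min (a₀ / (3 / 2)) (c₀ / (C₀ + 1)) with hκ
  have hκ0 : 0 < κ := by positivity
  refine ⟨κ / 2, by positivity, Real.sqrt (6 * (C₀ + 3)), by positivity, ?_⟩
  intro r hr v w h t ht
  have hr0 : 0 < r := hε.trans_le hr
  set a := r ^ (2 * σ₁) + r ^ (2 * σ₂) with ha
  set b := r ^ (2 * σ) with hb
  have hb0 : 0 < b := Real.rpow_pos_of_pos hr0 _
  have hP0 : 0 < r ^ (2 * σ₁) := Real.rpow_pos_of_pos hr0 _
  have hQ0 : 0 < r ^ (2 * σ₂) := Real.rpow_pos_of_pos hr0 _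
  have ha0 : 0 < a := by positivity
  have h1 : a₀ ≤ a := by
    have : a₀ ≤ r ^ (2 * σ₂) := Real.rpow_le_rpow hε.le hr (by linarith)
    linarith
  have h2 : b ≤ C₀ * a ^ 2 := by
    have e1 : b = r ^ (2 * σ - 4 * σ₂) * (r ^ (2 * σ₂)) ^ 2 := by
      rw [sq, ← Real.rpow_add hr0, ← Real.rpow_add hr0, hb]
      congr 1
      ring
    rw [e1]
    gcongr
    · exact hmono hr (by linarith)
    · linarith
  have h3 : c₀ * a ≤ b := by
    rw [hc₀, inv_mul_le_iff₀ (by positivity)]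
    have e1 : r ^ (2 * σ₁) = r ^ (2 * σ₁ - 2 * σ) * b := by
      rw [hb, ← Real.rpow_add hr0]
      congr 1
      ring
    have e2 : r ^ (2 * σ₂) = r ^ (2 * σ₂ - 2 * σ) * b := by
      rw [hb, ← Real.rpow_add hr0]
      congr 1
      ring
    rw [ha, e1, e2, ← add_mul]
    gcongr ?_ * _
    exact add_le_add (hmono hr (by linarith)) (hmono hr (by linarith))
  have hκ1 : κ * (3 / 2) ≤ a := by
    have := min_le_left (a₀ / (3 / 2)) (c₀ / (C₀ + 1))
    rw [← hκ, le_div_iff₀ (by norm_num)] at this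
    linarith
  have hκ2 : κ * (C₀ + 1) ≤ c₀ := by
    have := min_le_right (a₀ / (3 / 2)) (c₀ / (C₀ + 1))
    rwa [← hκ, le_div_iff₀ (by positivity)] at this
  have hen : ∀ x y : ℝ, κ * (y ^ 2 + (b + a ^ 2 / 2) * x ^ 2 + a * (x * y)) ≤
      a * y ^ 2 + a * b * x ^ 2 := by
    intro x y
    have s1 : y ^ 2 + (b + a ^ 2 / 2) * x ^ 2 + a * (x * y) ≤
        3 / 2 * y ^ 2 + (C₀ + 1) * (a ^ 2 * x ^ 2) := by
      nlinarith [sq_nonneg (y - a * x), mul_le_mul_of_nonneg_right h2 (sq_nonneg x)]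
    have s2 : κ * (3 / 2) * y ^ 2 ≤ a * y ^ 2 := by gcongr
    have s3 : κ * (C₀ + 1) * (a ^ 2 * x ^ 2) ≤ c₀ * (a ^ 2 * x ^ 2) := by gcongr
    have s4 : c₀ * a * (a * x ^ 2) ≤ b * (a * x ^ 2) := by gcongr
    have s5 := mul_le_mul_of_nonneg_left s1 hκ0.le
    nlinarith
  have h4 := sq_norm_le_of_ode hb0.le hen h ht
  have h5 : (a * ‖v t‖) ^ 2 ≤ (Real.sqrt (6 * (C₀ + 3)) * Real.exp (-(κ / 2) * t) *
      (a * ‖v 0‖ + ‖w 0‖)) ^ 2 := by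
    have e1 : Real.exp (-(κ / 2) * t) ^ 2 = Real.exp (-κ * t) := by
      rw [← Real.exp_nat_mul]
      congr 1
      push_cast
      ring
    rw [mul_pow, mul_pow, mul_pow, Real.sq_sqrt (by positivity), e1]
    refine h4.trans ?_
    rw [show ∀ X Y : ℝ, 6 * (C₀ + 3) * X * Y = 6 * X * ((C₀ + 3) * Y) by intros; ring]
    gcongr
    have s1 := mul_le_mul_of_nonneg_right h2 (sq_nonneg ‖v 0‖)
    have s2 : 0 ≤ a * ‖v 0‖ * ‖w 0‖ := by positivity
    have s3 : 0 ≤ C₀ * (a * ‖v 0‖ * ‖w 0‖) := by positivity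
    have s4 : 0 ≤ C₀ * ‖w 0‖ ^ 2 := by positivity
    nlinarith [sq_nonneg (a * ‖v 0‖), sq_nonneg ‖w 0‖]
  have h6 := le_of_sq_le_sq h5 (by positivity)
  have h7 : r ^ (-(2 * σ₂)) * a ≥ 1 := by
    rw [Real.rpow_neg hr0.le, ge_iff_le, ← div_eq_inv_mul, one_le_div hQ0]
    linarith
  have h8 : a * ‖v t‖ ≤ a * (Real.sqrt (6 * (C₀ + 3)) * Real.exp (-(κ / 2) * t) *
      (‖v 0‖ + r ^ (-(2 * σ₂)) * ‖w 0‖)) := by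
    refine h6.trans ?_
    rw [mul_left_comm a]
    gcongr
    rw [mul_add, ← mul_assoc a]
    gcongr
    have := mul_le_mul_of_nonneg_right h7 (norm_nonneg (w 0))
    linarith
  exact le_of_mul_le_mul_left h8 ha0

end Ode

/-! ### Pointwise bounds for the error of the expansion -/

/-- The growth exponent at low frequencies of the error of the expansion. -/
def lowExponent (σ σ₁ σ₂ s : ℝ) (k : ℕ) : ℝ :=
  s - 2 * σ₁ + 2 * min (σ₂ - σ₁) (σ - 2 * σ₁) * k

section Pointwise

variable {σ σ₁ σ₂ s : ℝ}

theorem rpow_le_rpow_min {r : ℝ} (hr : 0 < r) (hr1 : r ≤ 1) :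
    r ^ (2 * (σ₂ - σ₁)) ≤ r ^ (2 * min (σ₂ - σ₁) (σ - 2 * σ₁)) ∧
    r ^ (2 * (σ - 2 * σ₁)) ≤ r ^ (2 * min (σ₂ - σ₁) (σ - 2 * σ₁)) :=
  ⟨Real.rpow_le_rpow_of_exponent_ge hr hr1
      (mul_le_mul_of_nonneg_left (min_le_left _ _) zero_le_two),
    Real.rpow_le_rpow_of_exponent_ge hr hr1
      (mul_le_mul_of_nonneg_left (min_le_right _ _) zero_le_two)⟩

theorem rpow_lowExponent {r : ℝ} (hr : 0 < r) (k : ℕ) :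
    r ^ lowExponent σ σ₁ σ₂ s k = r ^ s * (r ^ (2 * σ₁))⁻¹ *
      (r ^ (2 * min (σ₂ - σ₁) (σ - 2 * σ₁))) ^ k := by
  rw [lowExponent, Real.rpow_add hr, Real.rpow_sub hr, Real.rpow_mul hr.le (2 * _) (k : ℝ),
    Real.rpow_natCast]
  rfl

/-- The profile error at low frequencies. -/
theorem exists_lowFrequency_bound (hσ₁ : 0 < σ₁) (hσ₁σ : σ₁ < σ / 2) (hσσ₂ : σ / 2 < σ₂)
    (k : ℕ) :
    ∃ ε > 0, ∃ C > 0, ∀ r, 0 < r → r ≤ ε → ∀ v w, SolvesOde σ σ₁ σ₂ r v w → ∀ t, 0 ≤ t →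
      r ^ s * ‖v t - (A0 σ σ₁ σ₂ k t r : ℂ) * v 0 - (A1 σ σ₁ σ₂ k t r : ℂ) * w 0‖ ≤
        C * (‖v 0‖ + ‖w 0‖) *
          (r ^ lowExponent σ σ₁ σ₂ s k * Real.exp (-(r ^ (2 * (σ - σ₁)) * t) / 2)) := by
  obtain ⟨η, hη⟩ : ∃ η, IsGoodRadius η := exists_hasDoubleSeries
  have hη0 := hη.1
  set δ := min (σ₂ - σ₁) (σ - 2 * σ₁) with hδ
  have hδ0 : 0 < δ := lt_min (by linarith) (by linarith)
  -- This threshold means `r^{2δ} ≤ η`, so that the remainder estimates apply with `θ = r^{2δ} / η ≤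
  -- 1`.
  refine ⟨η ^ (2 * δ)⁻¹, by positivity, 4 * (η⁻¹) ^ k, by positivity, ?_⟩
  intro r hr hrε v w h t ht
  have hrδ : r ^ (2 * δ) ≤ η := by
    have := Real.rpow_le_rpow hr.le hrε (show 0 ≤ 2 * δ by positivity)
    rwa [← Real.rpow_mul hη0.le, inv_mul_cancel₀ (by positivity), Real.rpow_one] at this
  have hr1 : r ≤ 1 := hrε.trans
    (Real.rpow_le_one hη0.le (hη.2.1.trans (by norm_num)) (by positivity))
  obtain ⟨hp, hq⟩ := rpow_le_rpow_min (σ := σ) (σ₁ := σ₁) (σ₂ := σ₂) hr hr1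
  rw [← hδ] at hp hq
  have hp0 : 0 < r ^ (2 * (σ₂ - σ₁)) := Real.rpow_pos_of_pos hr _
  have hq0 : 0 < r ^ (2 * (σ - 2 * σ₁)) := Real.rpow_pos_of_pos hr _
  have hP0 : 0 < r ^ (2 * σ₁) := Real.rpow_pos_of_pos hr _
  have hθ : r ^ (2 * δ) / η * η = r ^ (2 * δ) := div_mul_cancel₀ _ hη0.ne'
  have hθ1 : r ^ (2 * δ) / η ≤ 1 := (div_le_one hη0).2 hrδ
  have hD := (disc_pos (A := r ^ (2 * (σ₂ - σ₁))) (B := r ^ (2 * (σ - 2 * σ₁)))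
    (by rw [abs_of_pos hp0]; linarith [hη.2.1]) (by rw [abs_of_pos hq0]; linarith [hη.2.1])).2
  rw [h.eq_explicit hr hD ht]
  have b0 := abs_E0_sub_A0_le hη hr ht (by positivity) hθ1 (hθ ▸ hp) (hθ ▸ hq) k
  have b1 := abs_E1_sub_A1_le hη hr ht (by positivity) hθ1 (hθ ▸ hp) (hθ ▸ hq) k
  rw [← (rpow_two_mul_sub (σ := σ) (σ₁ := σ₁) (σ₂ := σ₂) hr).2.2] at b0 b1
  have hYX : Real.exp (-(r ^ (2 * σ₁) * t) / 2) ≤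
      Real.exp (-(r ^ (2 * (σ - σ₁)) * t) / 2) := by
    have : r ^ (2 * (σ - σ₁)) ≤ r ^ (2 * σ₁) :=
      Real.rpow_le_rpow_of_exponent_ge hr hr1 (by linarith)
    gcongr
  have hX := Real.exp_pos (-(r ^ (2 * (σ - σ₁)) * t) / 2)
  generalize Real.exp (-(r ^ (2 * (σ - σ₁)) * t) / 2) = X at *
  generalize Real.exp (-(r ^ (2 * σ₁) * t) / 2) = Y at *
  -- The term of `v 0` lacks the factor `r^{-2σ₁}`; as this factor is at least 1, both terms can be
  -- given the same bound.
  have hP1 : 1 ≤ (r ^ (2 * σ₁))⁻¹ :=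
    (one_le_inv₀ hP0).2 (Real.rpow_le_one hr.le hr1 (by positivity))
  have hXY : 2 * (X + Y) ≤ 4 * X := by linarith
  have c0 : |E0 σ σ₁ σ₂ t r - A0 σ σ₁ σ₂ k t r| ≤
      (r ^ (2 * σ₁))⁻¹ * ((r ^ (2 * δ) / η) ^ k * (4 * X)) := by
    refine b0.trans ((mul_le_mul_of_nonneg_left hXY (by positivity)).trans ?_)
    exact le_mul_of_one_le_left (by positivity) hP1
  have c1 : |E1 σ σ₁ σ₂ t r - A1 σ σ₁ σ₂ k t r| ≤
      (r ^ (2 * σ₁))⁻¹ * ((r ^ (2 * δ) / η) ^ k * (4 * X)) := by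
    refine b1.trans ?_
    gcongr
  have e1 : (E0 σ σ₁ σ₂ t r : ℂ) * v 0 + (E1 σ σ₁ σ₂ t r : ℂ) * w 0 -
      (A0 σ σ₁ σ₂ k t r : ℂ) * v 0 - (A1 σ σ₁ σ₂ k t r : ℂ) * w 0 =
      ((E0 σ σ₁ σ₂ t r - A0 σ σ₁ σ₂ k t r : ℝ) : ℂ) * v 0 +
      ((E1 σ σ₁ σ₂ t r - A1 σ σ₁ σ₂ k t r : ℝ) : ℂ) * w 0 := by
    push_cast
    ring
  rw [e1]
  have e2 : ‖((E0 σ σ₁ σ₂ t r - A0 σ σ₁ σ₂ k t r : ℝ) : ℂ) * v 0 +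
      ((E1 σ σ₁ σ₂ t r - A1 σ σ₁ σ₂ k t r : ℝ) : ℂ) * w 0‖ ≤
      (r ^ (2 * σ₁))⁻¹ * ((r ^ (2 * δ) / η) ^ k * (4 * X)) * (‖v 0‖ + ‖w 0‖) := by
    refine (norm_add_le _ _).trans ?_
    rw [norm_mul, norm_mul, Complex.norm_real, Complex.norm_real, mul_add]
    exact add_le_add (mul_le_mul_of_nonneg_right c0 (norm_nonneg _))
      (mul_le_mul_of_nonneg_right c1 (norm_nonneg _))
  refine (mul_le_mul_of_nonneg_left e2 (Real.rpow_nonneg hr.le s)).trans (le_of_eq ?_)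
  rw [rpow_lowExponent hr, ← hδ, div_eq_mul_inv, mul_pow]
  ring

/-- For `t ≥ 1` the exponent `r^γ t / 2` is at least `r^γ / 4 + ε^γ t / 4`: the first part absorbs
the polynomial growth in `r`, the second gives decay in `t`. No such absorption is available at `t =
0`. -/
theorem exists_one_add_rpow_mul_exp_le {m γ ε : ℝ} (hm : 0 ≤ m) (hγ : 0 < γ) (hε : 0 < ε) :
    ∃ c > 0, ∃ C > 0, ∀ r t, ε ≤ r → 1 ≤ t →
      (1 + r) ^ m * Real.exp (-(r ^ γ * t) / 2) ≤ C * Real.exp (-c * t) := by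
  obtain ⟨M, hM⟩ := exists_nat_ge (m / γ)
  rw [div_le_iff₀ hγ] at hM
  refine ⟨ε ^ γ / 4, by positivity,
    (1 / ε + 1) ^ m * ε ^ (m - M * γ) * (4 ^ M * M.factorial), by positivity, ?_⟩
  intro r t hr ht
  have hr0 : 0 < r := hε.trans_le hr
  have h1 : (1 + r) ^ m ≤ (1 / ε + 1) ^ m * r ^ m := by
    rw [← Real.mul_rpow (by positivity) hr0.le]
    apply Real.rpow_le_rpow (by positivity) _ hm
    have : 1 ≤ 1 / ε * r := by
      rw [div_mul_eq_mul_div, one_mul, one_le_div hε]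
      exact hr
    linarith
  have h2 : r ^ m ≤ ε ^ (m - M * γ) * (r ^ γ) ^ M := by
    have e1 : r ^ m = r ^ (m - M * γ) * (r ^ γ) ^ M := by
      rw [← Real.rpow_natCast, ← Real.rpow_mul hr0.le, ← Real.rpow_add hr0]
      congr 1
      ring
    rw [e1]
    gcongr ?_ * _
    exact Real.rpow_le_rpow_of_nonpos hε hr (by linarith)
  have h3 : (r ^ γ) ^ M ≤ 4 ^ M * M.factorial * Real.exp (r ^ γ / 4) := by
    have := Real.pow_div_factorial_le_exp (r ^ γ / 4) (by positivity) M
    rw [div_le_iff₀ (by positivity), div_pow, div_le_iff₀ (by positivity)] at this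
    linarith
  have h4 : Real.exp (-(r ^ γ * t) / 2) ≤
      Real.exp (-(r ^ γ / 4)) * Real.exp (-(ε ^ γ / 4) * t) := by
    rw [← Real.exp_add]
    gcongr
    have s1 : ε ^ γ ≤ r ^ γ := Real.rpow_le_rpow hε.le hr hγ.le
    have s2 : 0 < r ^ γ := by positivity
    nlinarith
  calc (1 + r) ^ m * Real.exp (-(r ^ γ * t) / 2)
      ≤ ((1 / ε + 1) ^ m * (ε ^ (m - M * γ) * (4 ^ M * M.factorial * Real.exp (r ^ γ / 4)))) *
        (Real.exp (-(r ^ γ / 4)) * Real.exp (-(ε ^ γ / 4) * t)) := by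
        gcongr
        refine h1.trans ?_
        gcongr
        refine h2.trans ?_
        gcongr
    _ = (1 / ε + 1) ^ m * ε ^ (m - M * γ) * (4 ^ M * M.factorial) *
        Real.exp (-(ε ^ γ / 4) * t) * (Real.exp (r ^ γ / 4) * Real.exp (-(r ^ γ / 4))) := by ring
    _ = _ := by rw [← Real.exp_add, add_neg_cancel, Real.exp_zero, mul_one]

/-- The profiles decay exponentially in time at high frequencies. -/
theorem exists_profile_highFrequency_decay (hσ₁ : 0 < σ₁) (hσ₁σ : σ₁ < σ / 2)
    (hσσ₂ : σ / 2 < σ₂) (hσ₂ : σ₂ ≤ σ) (hs : 0 ≤ s) {ε : ℝ} (hε : 0 < ε) (k : ℕ) :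
    ∃ c > 0, ∃ C > 0, ∀ r t, ε ≤ r → 1 ≤ t →
      r ^ s * |A0 σ σ₁ σ₂ k t r| ≤ C * Real.exp (-c * t) ∧
      r ^ s * |A1 σ σ₁ σ₂ k t r| ≤ C * Real.exp (-c * t) := by
  obtain ⟨η, hη⟩ : ∃ η, IsGoodRadius η := exists_hasDoubleSeries
  have hη0 := hη.1
  have hσ : 0 < σ := by linarith
  -- The growth to be absorbed is `s` from the weight, `2σ` from the prefactor of the kernels, and
  -- `2σ k` from `θ ^ k`, where `θ` is of the order of `(1 + r)^{2σ}`.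
  set m := s + 2 * σ + 2 * σ * k with hm
  have hm0 : 0 ≤ m := by positivity
  obtain ⟨c₁, hc₁, C₁, hC₁, h₁⟩ := exists_one_add_rpow_mul_exp_le hm0
    (show 0 < 2 * (σ - σ₁) by linarith) hε
  obtain ⟨c₂, hc₂, C₂, hC₂, h₂⟩ := exists_one_add_rpow_mul_exp_le hm0
    (show 0 < 2 * σ₁ by linarith) hε
  set D := (2 + (ε ^ (2 * σ₁))⁻¹) * ((2 / η) ^ k * 2) with hDdef
  have hD : 0 < D := by positivity
  refine ⟨min c₁ c₂, lt_min hc₁ hc₂, D * (C₁ + C₂), by positivity, ?_⟩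
  intro r t hr ht
  have hr0 : 0 < r := hε.trans_le hr
  have hb : ∀ x, 0 ≤ x → x ≤ 2 * σ → r ^ x ≤ (1 + r) ^ (2 * σ) := fun x hx hx' =>
    (Real.rpow_le_rpow hr0.le (by linarith) hx).trans
      (Real.rpow_le_rpow_of_exponent_le (by linarith) hx')
  have hone : 1 ≤ (1 + r) ^ (2 * σ) := Real.one_le_rpow (by linarith) (by positivity)
  have hη1 : η ≤ 1 := hη.2.1.trans (by norm_num)
  set R := (1 + r) ^ (2 * σ) with hR
  set θ := 2 / η * R with hθ
  have hθη : θ * η = 2 * R := by rw [hθ]; field_simp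
  have hθ1 : 1 ≤ θ := by
    have : 1 ≤ 2 / η := by rw [one_le_div hη0]; linarith
    exact one_le_mul_of_one_le_of_one_le this hone
  have hp : r ^ (2 * (σ₂ - σ₁)) ≤ θ * η := by
    rw [hθη]
    linarith [hb (2 * (σ₂ - σ₁)) (by linarith) (by linarith)]
  have hq : r ^ (2 * (σ - 2 * σ₁)) ≤ θ * η := by
    rw [hθη]
    linarith [hb (2 * (σ - 2 * σ₁)) (by linarith) (by linarith)]
  have hX := h₁ r t hr ht
  have hY := h₂ r t hr ht
  have ht0 : 0 ≤ t := by linarith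
  have hr1 : (1 + r) ^ m = (1 + r) ^ s * R * R ^ k := by
    rw [hm, Real.rpow_add (by linarith), Real.rpow_add (by linarith),
      Real.rpow_mul (by linarith) (2 * σ) (k : ℝ), Real.rpow_natCast]
  have b0 := abs_A0_le (σ := σ) hη hr0 ht0 hθ1 hp hq k
  have b1 := abs_A1_le (σ := σ) hη hr0 ht0 hθ1 hp hq k
  rw [← (rpow_two_mul_sub (σ := σ) (σ₁ := σ₁) (σ₂ := σ₂) hr0).2.2] at b0 b1
  have hX0 := Real.exp_pos (-(r ^ (2 * (σ - σ₁)) * t) / 2)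
  have hY0 := Real.exp_pos (-(r ^ (2 * σ₁) * t) / 2)
  generalize Real.exp (-(r ^ (2 * (σ - σ₁)) * t) / 2) = X at *
  generalize Real.exp (-(r ^ (2 * σ₁) * t) / 2) = Y at *
  have hE1 : Real.exp (-c₁ * t) ≤ Real.exp (-min c₁ c₂ * t) := by
    have := min_le_left c₁ c₂
    gcongr
  have hE2 : Real.exp (-c₂ * t) ≤ Real.exp (-min c₁ c₂ * t) := by
    have := min_le_right c₁ c₂
    gcongr
  have hsum : (1 + r) ^ m * (X + Y) ≤ (C₁ + C₂) * Real.exp (-min c₁ c₂ * t) := by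
    rw [mul_add, add_mul]
    exact add_le_add (hX.trans (by gcongr)) (hY.trans (by gcongr))
  have hrs : r ^ s ≤ (1 + r) ^ s := Real.rpow_le_rpow hr0.le (by linarith) hs
  have hPε : (r ^ (2 * σ₁))⁻¹ ≤ (ε ^ (2 * σ₁))⁻¹ := by
    have := Real.rpow_le_rpow hε.le hr (show 0 ≤ 2 * σ₁ by linarith)
    gcongr
  have hP0 : 0 < (ε ^ (2 * σ₁))⁻¹ := by positivity
  have main : ∀ y z : ℝ, 0 ≤ z → z ≤ (2 + (ε ^ (2 * σ₁))⁻¹) * R →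
      y ≤ z * (θ ^ k * (2 * (X + Y))) →
      r ^ s * y ≤ D * (C₁ + C₂) * Real.exp (-min c₁ c₂ * t) := by
    intro y z hz0 hz hy
    calc r ^ s * y ≤ (1 + r) ^ s * ((2 + (ε ^ (2 * σ₁))⁻¹) * R * (θ ^ k * (2 * (X + Y)))) := by
          refine (mul_le_mul_of_nonneg_left hy (Real.rpow_nonneg hr0.le s)).trans ?_
          gcongr
      _ = D * ((1 + r) ^ m * (X + Y)) := by
          rw [hr1, hθ, hDdef, mul_pow]
          ring
      _ ≤ D * ((C₁ + C₂) * Real.exp (-min c₁ c₂ * t)) := by gcongr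
      _ = _ := by ring
  have hqR : r ^ (2 * (σ - 2 * σ₁)) ≤ R := hb _ (by linarith) (by linarith)
  constructor
  · refine main _ _ (by positivity) ?_ b0
    nlinarith
  · refine main _ _ (by positivity) (hPε.trans ?_) b1
    nlinarith

theorem rpow_le_one_add_sq_rpow {r x : ℝ} (hr : 0 < r) (hx : 0 ≤ x) :
    r ^ x ≤ (1 + r ^ 2) ^ (x / 2) := by
  have h1 : r ^ x = (r ^ 2) ^ (x / 2) := by
    rw [← Real.rpow_natCast, ← Real.rpow_mul hr.le]
    congr 1
    push_cast
    ring
  rw [h1]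
  exact Real.rpow_le_rpow (by positivity) (by linarith) (by positivity)

/-- The error of the expansion at high frequencies. -/
theorem exists_highFrequency_bound (hσ₁ : 0 < σ₁) (hσ₁σ : σ₁ < σ / 2) (hσσ₂ : σ / 2 < σ₂)
    (hσ₂ : σ₂ ≤ σ) (hs : 0 ≤ s) {ε : ℝ} (hε : 0 < ε) (k : ℕ) :
    ∃ c > 0, ∃ C > 0, ∀ r, ε ≤ r → ∀ v w, SolvesOde σ σ₁ σ₂ r v w → ∀ t, 1 ≤ t →
      r ^ s * ‖v t - (A0 σ σ₁ σ₂ k t r : ℂ) * v 0 - (A1 σ σ₁ σ₂ k t r : ℂ) * w 0‖ ≤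
        C * Real.exp (-c * t) * ((1 + r ^ 2) ^ (s / 2) * ‖v 0‖ +
          (1 + r ^ 2) ^ (max (s - 2 * σ₂) 0 / 2) * ‖w 0‖) := by
  obtain ⟨κ, hκ, C₁, hC₁, h₁⟩ := exists_highFrequency_decay (σ := σ) (σ₁ := σ₁) (σ₂ := σ₂)
    (by linarith) hσσ₂ hσ₂ hε
  obtain ⟨c, hc, C₂, hC₂, h₂⟩ := exists_profile_highFrequency_decay (σ := σ) (σ₁ := σ₁)
    (σ₂ := σ₂) hσ₁ hσ₁σ hσσ₂ hσ₂ hs hε k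
  refine ⟨min κ c, lt_min hκ hc, C₁ * (1 + ε ^ (s - 2 * σ₂)) + C₂, by positivity, ?_⟩
  intro r hr v w h t ht
  have hr0 : 0 < r := hε.trans_le hr
  have a1 := h₁ r hr v w h t (by linarith)
  obtain ⟨a2, a3⟩ := h₂ r t hr ht
  have hE1 : Real.exp (-κ * t) ≤ Real.exp (-min κ c * t) := by
    have := min_le_left κ c
    gcongr
  have hE2 : Real.exp (-c * t) ≤ Real.exp (-min κ c * t) := by
    have := min_le_right κ c
    gcongr
  set E := Real.exp (-min κ c * t)
  have hE0 : 0 < E := Real.exp_pos _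
  set W := (1 + r ^ 2) ^ (s / 2) with hW
  set W' := (1 + r ^ 2) ^ (max (s - 2 * σ₂) 0 / 2) with hW'
  have hW1 : 1 ≤ W := Real.one_le_rpow (by nlinarith) (by positivity)
  have hW'1 : 1 ≤ W' := Real.one_le_rpow (by nlinarith) (by positivity)
  have hrW : r ^ s ≤ W := rpow_le_one_add_sq_rpow hr0 hs
  -- If `s ≥ 2σ₂` the power is controlled by the Sobolev weight of `u₁`; otherwise it is nonpositive
  -- and bounded by its value at `ε`.
  have hrW' : r ^ s * r ^ (-(2 * σ₂)) ≤ (1 + ε ^ (s - 2 * σ₂)) * W' := by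
    have hε0 : 0 < ε ^ (s - 2 * σ₂) := by positivity
    rw [← Real.rpow_add hr0, ← sub_eq_add_neg]
    rcases le_total 0 (s - 2 * σ₂) with h0 | h0
    · have e1 := rpow_le_one_add_sq_rpow hr0 h0
      rw [hW', max_eq_left h0]
      exact e1.trans (le_mul_of_one_le_left (by positivity) (by linarith))
    · have e1 := Real.rpow_le_rpow_of_nonpos hε hr h0
      nlinarith
  have b1 : r ^ s * ‖v t‖ ≤ C₁ * (1 + ε ^ (s - 2 * σ₂)) * E * (W * ‖v 0‖ + W' * ‖w 0‖) := by
    have hε0 : 0 < ε ^ (s - 2 * σ₂) := by positivity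
    calc r ^ s * ‖v t‖ ≤ r ^ s * (C₁ * E * (‖v 0‖ + r ^ (-(2 * σ₂)) * ‖w 0‖)) := by
          gcongr
          refine a1.trans ?_
          gcongr
      _ = C₁ * E * (r ^ s * ‖v 0‖ + r ^ s * r ^ (-(2 * σ₂)) * ‖w 0‖) := by ring
      _ ≤ C₁ * E * ((1 + ε ^ (s - 2 * σ₂)) * W * ‖v 0‖ +
          (1 + ε ^ (s - 2 * σ₂)) * W' * ‖w 0‖) := by
          gcongr
          exact hrW.trans (le_mul_of_one_le_left (by positivity) (by linarith))
      _ = _ := by ring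
  have b2 : r ^ s * ‖(A0 σ σ₁ σ₂ k t r : ℂ) * v 0‖ ≤ C₂ * E * (W * ‖v 0‖) := by
    rw [norm_mul, Complex.norm_real, Real.norm_eq_abs, ← mul_assoc]
    have : ‖v 0‖ ≤ W * ‖v 0‖ := le_mul_of_one_le_left (norm_nonneg _) hW1
    exact mul_le_mul (a2.trans (by gcongr)) this (norm_nonneg _) (by positivity)
  have b3 : r ^ s * ‖(A1 σ σ₁ σ₂ k t r : ℂ) * w 0‖ ≤ C₂ * E * (W' * ‖w 0‖) := by
    rw [norm_mul, Complex.norm_real, Real.norm_eq_abs, ← mul_assoc]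
    have : ‖w 0‖ ≤ W' * ‖w 0‖ := le_mul_of_one_le_left (norm_nonneg _) hW'1
    exact mul_le_mul (a3.trans (by gcongr)) this (norm_nonneg _) (by positivity)
  have b4 : ‖v t - (A0 σ σ₁ σ₂ k t r : ℂ) * v 0 - (A1 σ σ₁ σ₂ k t r : ℂ) * w 0‖ ≤
      ‖v t‖ + ‖(A0 σ σ₁ σ₂ k t r : ℂ) * v 0‖ + ‖(A1 σ σ₁ σ₂ k t r : ℂ) * w 0‖ :=
    (norm_sub_le _ _).trans (add_le_add_left (norm_sub_le _ _) _)
  have b5 := mul_le_mul_of_nonneg_left b4 (Real.rpow_nonneg hr0.le s)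
  rw [mul_add, mul_add] at b5
  linarith

end Pointwise

/-! ### Fourier transforms and `L²` norms -/

section Fourier

variable {n : ℕ} {f : Rn n → ℂ}

theorem norm_hatL1_le (f : Rn n → ℂ) (ξ : Rn n) : ‖hatL1 f ξ‖ ≤ ∫ x, ‖f x‖ :=
  VectorFourier.norm_fourierIntegral_le_integral_norm _ _ _ _ _

theorem continuous_hatL1 (hf : Integrable f) : Continuous (hatL1 f) := by
  have h : Continuous (𝓕 f) :=
    VectorFourier.fourierIntegral_continuous Real.continuous_fourierChar continuous_inner hf
  exact h.comp (continuous_const_smul _)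

theorem hatL1_zero (f : Rn n → ℂ) : hatL1 f 0 = ∫ x, f x := by
  rw [hatL1_eq_integral]
  simp

theorem ofReal_integral_norm (hf : Integrable f) :
    ENNReal.ofReal (∫ x, ‖f x‖) = eLpNorm f 1 volume := by
  rw [eLpNorm_one_eq_lintegral_enorm, ofReal_integral_norm_eq_lintegral_enorm hf]

end Fourier

/-- Since `n > 0` the origin is a null set, so at a fixed time the estimates for `r > 0` hold at
almost every frequency. -/
theorem ae_solvesOde {n : ℕ} (hn : 0 < n) {σ σ₁ σ₂ : ℝ} {u₀ u₁ : Rn n → ℂ}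
    {u : ℝ → Lp ℂ 2 (volume : Measure (Rn n))} (h : IsSolution σ σ₁ σ₂ u₀ u₁ u) {t : ℝ}
    (ht : 0 ≤ t) :
    ∀ᵐ ξ ∂(volume : Measure (Rn n)), 0 < ‖ξ‖ ∧ ∃ v w : ℝ → ℂ, SolvesOde σ σ₁ σ₂ ‖ξ‖ v w ∧
      v 0 = hatL1 u₀ ξ ∧ w 0 = hatL1 u₁ ξ ∧ hatL2 (u t) ξ = v t := by
  have : Nonempty (Fin n) := ⟨⟨0, hn⟩⟩
  obtain ⟨v, w, h1, h2⟩ := h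
  have h0 : ∀ᵐ ξ ∂(volume : Measure (Rn n)), ξ ≠ 0 := by
    simp [ae_iff, measure_singleton]
  filter_upwards [h0, h1 t ht, h2] with ξ hξ h3 h4
  exact ⟨norm_pos_iff.2 hξ, fun τ => v τ ξ, fun τ => w τ ξ, h4.2.2, h4.1, h4.2.1, h3⟩

/-- In polar coordinates the square integrates to a Gamma function times a power of `t`; `hβ` is the
integrability at the origin. -/
theorem exists_eLpNorm_rpow_mul_exp_le {n : ℕ} (hn : 0 < n) {β γ : ℝ} (hβ : 0 < 2 * β + n)
    (hγ : 0 < γ) :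
    ∃ C > 0, ∀ t, 0 < t →
      eLpNorm (fun ξ : Rn n => ‖ξ‖ ^ β * Real.exp (-(‖ξ‖ ^ γ * t) / 2)) 2 volume ≤
        ENNReal.ofReal (C * t ^ (-(2 * β + n) / (2 * γ))) := by
  have : Nonempty (Fin n) := ⟨⟨0, hn⟩⟩
  set K : ℝ := (Module.finrank ℝ (Rn n)) • (volume : Measure (Rn n)).real (Metric.ball 0 1) •
    ((1 / γ) * Real.Gamma ((2 * β + n) / γ)) with hK
  have hG : 0 < Real.Gamma ((2 * β + n) / γ) := Real.Gamma_pos_of_pos (by positivity)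
  have hK0 : 0 ≤ K := by
    rw [hK, nsmul_eq_mul, smul_eq_mul]
    positivity
  -- The summand 1 only makes the constant visibly positive.
  refine ⟨Real.sqrt (K + 1), by positivity, ?_⟩
  intro t ht
  have hsq : ∀ ξ : Rn n, (‖ξ‖ ^ β * Real.exp (-(‖ξ‖ ^ γ * t) / 2)) ^ 2 =
      ‖ξ‖ ^ (2 * β) * Real.exp (-t * ‖ξ‖ ^ γ) := by
    intro ξ
    rw [mul_pow, ← Real.rpow_mul_natCast (norm_nonneg ξ), ← Real.exp_nat_mul]
    congr 2 <;> push_cast <;> ring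
  have hrad : ∀ y ∈ Set.Ioi (0 : ℝ), y ^ (Module.finrank ℝ (Rn n) - 1) •
      (y ^ (2 * β) * Real.exp (-t * y ^ γ)) =
      y ^ (2 * β + n - 1) * Real.exp (-t * y ^ γ) := by
    intro y hy
    rw [smul_eq_mul, ← mul_assoc, ← Real.rpow_natCast, ← Real.rpow_add hy,
      finrank_euclideanSpace_fin, Nat.cast_sub hn]
    congr 2
    push_cast
    ring
  have hint : Integrable (fun ξ : Rn n => ‖ξ‖ ^ (2 * β) * Real.exp (-t * ‖ξ‖ ^ γ)) := by
    rw [integrable_fun_norm_addHaar volume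
      (f := fun y => y ^ (2 * β) * Real.exp (-t * y ^ γ))]
    refine (integrableOn_congr_fun hrad measurableSet_Ioi).2 ?_
    exact integrableOn_rpow_mul_exp_neg_mul_rpow (by linarith) hγ ht
  have hval : ∫ ξ : Rn n, ‖ξ‖ ^ (2 * β) * Real.exp (-t * ‖ξ‖ ^ γ) =
      K * t ^ (-(2 * β + n) / γ) := by
    rw [integral_fun_norm_addHaar volume (fun y => y ^ (2 * β) * Real.exp (-t * y ^ γ)),
      setIntegral_congr_fun measurableSet_Ioi hrad,
      integral_rpow_mul_exp_neg_mul_rpow hγ (by linarith) ht, hK]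
    simp only [nsmul_eq_mul, smul_eq_mul, sub_add_cancel]
    ring
  have hmeas : AEStronglyMeasurable
      (fun ξ : Rn n => ‖ξ‖ ^ β * Real.exp (-(‖ξ‖ ^ γ * t) / 2)) volume := by
    apply Measurable.aestronglyMeasurable
    fun_prop
  have hmem : MemLp (fun ξ : Rn n => ‖ξ‖ ^ β * Real.exp (-(‖ξ‖ ^ γ * t) / 2)) 2 volume := by
    rw [memLp_two_iff_integrable_sq hmeas]
    simpa only [hsq] using hint
  rw [hmem.eLpNorm_eq_integral_rpow_norm two_ne_zero ENNReal.ofNat_ne_top]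
  apply ENNReal.ofReal_le_ofReal
  have e1 : ∫ ξ : Rn n, ‖‖ξ‖ ^ β * Real.exp (-(‖ξ‖ ^ γ * t) / 2)‖ ^ (2 : ENNReal).toReal =
      K * t ^ (-(2 * β + n) / γ) := by
    rw [← hval]
    refine integral_congr_ae (Eventually.of_forall fun ξ => ?_)
    simp only [ENNReal.toReal_ofNat, Real.rpow_ofNat, Real.norm_eq_abs, sq_abs, hsq]
  rw [e1, ENNReal.toReal_ofNat, Real.mul_rpow hK0 (by positivity), ← Real.rpow_mul ht.le,
    Real.sqrt_eq_rpow, one_div]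
  have e2 : -(2 * β + n) / γ * 2⁻¹ = -(2 * β + n) / (2 * γ) := by field_simp
  rw [e2]
  gcongr
  linarith

theorem exists_exp_le_rpow {c ρ : ℝ} (hc : 0 < c) (hρ : ρ ≤ 0) :
    ∃ C > 0, ∀ t, 0 ≤ t → Real.exp (-c * t) ≤ C * (1 + t) ^ ρ := by
  -- `d ≤ 1` gives `d (1 + t) ≤ exp (d t)`, and `d (1 - ρ) ≤ c` ensures that the power `ρ` of this
  -- exponential still dominates `exp (-c t)`.
  set d := min 1 (c / (1 - ρ)) with hd
  have hρ1 : 0 < 1 - ρ := by linarith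
  have hd0 : 0 < d := by positivity
  have hd1 : d ≤ 1 := min_le_left _ _
  have hd2 : d * (1 - ρ) ≤ c := by
    rw [← le_div_iff₀ hρ1]
    exact min_le_right _ _
  refine ⟨d ^ ρ, by positivity, ?_⟩
  intro t ht
  rw [← Real.mul_rpow hd0.le (by linarith)]
  have h1 : d * (1 + t) ≤ Real.exp (d * t) := by
    have := Real.add_one_le_exp (d * t)
    nlinarith
  have h2 := Real.rpow_le_rpow_of_nonpos (by positivity) h1 hρ
  refine le_trans ?_ h2
  rw [← Real.exp_mul]
  apply Real.exp_le_exp.2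
  have h3 : 0 ≤ (c + d * ρ) * t := mul_nonneg (by linarith) ht
  linarith

theorem rate_eq {n k : ℕ} {σ σ₁ σ₂ s : ℝ} (h : σ₁ < σ) :
    -(2 * lowExponent σ σ₁ σ₂ s k + n) / (2 * (2 * (σ - σ₁))) = rate n σ σ₁ σ₂ s k := by
  have : σ - σ₁ ≠ 0 := by linarith
  rw [rate, lowExponent]
  field_simp
  ring

theorem lowExponent_pos {n k : ℕ} {σ σ₁ σ₂ s : ℝ} (hσ₁σ : σ₁ < σ / 2) (hσσ₂ : σ / 2 < σ₂)
    (hn : 4 * σ₁ < (n : ℝ)) (hs : 0 ≤ s) : 0 < 2 * lowExponent σ σ₁ σ₂ s k + n := by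
  have hδ0 : 0 < min (σ₂ - σ₁) (σ - 2 * σ₁) := lt_min (by linarith) (by linarith)
  have : 0 ≤ 2 * min (σ₂ - σ₁) (σ - 2 * σ₁) * k := by positivity
  rw [lowExponent]
  linarith

theorem rate_neg {n k : ℕ} {σ σ₁ σ₂ s : ℝ} (hσ₁ : 0 < σ₁) (hσ₁σ : σ₁ < σ / 2)
    (hσσ₂ : σ / 2 < σ₂) (hn : 4 * σ₁ < (n : ℝ)) (hs : 0 ≤ s) : rate n σ σ₁ σ₂ s k < 0 := by
  rw [← rate_eq (by linarith)]
  exact div_neg_of_neg_of_pos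
    (neg_neg_of_pos (lowExponent_pos hσ₁σ hσσ₂ hn hs)) (by linarith)

theorem norm_error {n : ℕ} {σ σ₁ σ₂ s : ℝ} {k : ℕ} {t : ℝ} (ξ : Rn n) (a b c : ℂ) :
    ‖((‖ξ‖ ^ s : ℝ) : ℂ) * a - ((‖ξ‖ ^ s : ℝ) : ℂ) * ((A0 σ σ₁ σ₂ k t ‖ξ‖ : ℝ) : ℂ) * b -
      ((‖ξ‖ ^ s : ℝ) : ℂ) * ((A1 σ σ₁ σ₂ k t ‖ξ‖ : ℝ) : ℂ) * c‖ =
    ‖ξ‖ ^ s * ‖a - (A0 σ σ₁ σ₂ k t ‖ξ‖ : ℂ) * b - (A1 σ σ₁ σ₂ k t ‖ξ‖ : ℂ) * c‖ := by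
  rw [mul_assoc, mul_assoc, ← mul_sub, ← mul_sub, norm_mul, Complex.norm_real, Real.norm_eq_abs,
    abs_of_nonneg (Real.rpow_nonneg (norm_nonneg ξ) s)]

/-! ### The upper bound -/

theorem expansionError_upper (n k : ℕ) {σ σ₁ σ₂ s : ℝ}
    (hσ₁ : 0 < σ₁) (hσ₁σ : σ₁ < σ / 2) (hσσ₂ : σ / 2 < σ₂) (hσ₂ : σ₂ ≤ σ)
    (hn : 4 * σ₁ < (n : ℝ)) (hs : 0 ≤ s) :
    ∃ C : ℝ, 0 < C ∧
      ∀ (u₀ u₁ : Rn n → ℂ) (u : ℝ → Lp ℂ 2 (volume : Measure (Rn n))),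
        MemData σ₂ s u₀ u₁ → IsSolution σ σ₁ σ₂ u₀ u₁ u → ∀ t : ℝ, 1 ≤ t →
          expansionError σ σ₁ σ₂ s k u₀ u₁ u t ≤
            ENNReal.ofReal (C * (1 + t) ^ rate n σ σ₁ σ₂ s k) * normData σ₂ s u₀ u₁ := by
  have hn0 : 0 < n := by
    have : (0 : ℝ) < n := by linarith
    exact_mod_cast this
  obtain ⟨ε, hε, C₁, hC₁, h₁⟩ := exists_lowFrequency_bound (s := s) hσ₁ hσ₁σ hσσ₂ k
  obtain ⟨c, hc, C₂, hC₂, h₂⟩ := exists_highFrequency_bound hσ₁ hσ₁σ hσσ₂ hσ₂ hs hε k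
  obtain ⟨C₃, hC₃, h₃⟩ := exists_eLpNorm_rpow_mul_exp_le (γ := 2 * (σ - σ₁)) hn0
    (lowExponent_pos (k := k) hσ₁σ hσσ₂ hn hs) (by linarith)
  have hρ := rate_neg (k := k) hσ₁ hσ₁σ hσσ₂ hn hs
  rw [rate_eq (by linarith)] at h₃
  set ρ := rate n σ σ₁ σ₂ s k
  obtain ⟨C₄, hC₄, h₄⟩ := exists_exp_le_rpow hc hρ.le
  -- The factor `2 ^ (-ρ)` converts `t ^ ρ` into `(1 + t) ^ ρ` for `t ≥ 1`.
  refine ⟨C₁ * (C₃ * 2 ^ (-ρ)) + C₂ * C₄, by positivity, ?_⟩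
  intro u₀ u₁ u hdata hsol t ht
  obtain ⟨⟨hi₀, -⟩, ⟨hi₁, -⟩⟩ := hdata
  have ht0 : 0 < t := by linarith
  set N := (∫ x, ‖u₀ x‖) + ∫ x, ‖u₁ x‖ with hN
  have hN0 : 0 ≤ N := add_nonneg (integral_nonneg fun _ => norm_nonneg _)
    (integral_nonneg fun _ => norm_nonneg _)
  set φ : Rn n → ℝ := fun ξ => ‖ξ‖ ^ lowExponent σ σ₁ σ₂ s k *
    Real.exp (-(‖ξ‖ ^ (2 * (σ - σ₁)) * t) / 2) with hφ
  set ψ₀ : Rn n → ℝ := fun ξ => (1 + ‖ξ‖ ^ 2) ^ (s / 2) * ‖hatL1 u₀ ξ‖ with hψ₀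
  set ψ₁ : Rn n → ℝ := fun ξ => (1 + ‖ξ‖ ^ 2) ^ (max (s - 2 * σ₂) 0 / 2) * ‖hatL1 u₁ ξ‖ with hψ₁
  set e := C₂ * Real.exp (-c * t) with he
  have he0 : 0 < e := by positivity
  have hm : AEStronglyMeasurable ((C₁ * N) • φ) volume := by
    apply Measurable.aestronglyMeasurable
    fun_prop
  have hm₀ : AEStronglyMeasurable (e • ψ₀) volume := by
    have := (continuous_hatL1 hi₀).measurable
    apply Measurable.aestronglyMeasurable
    fun_prop
  have hm₁ : AEStronglyMeasurable (e • ψ₁) volume := by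
    have := (continuous_hatL1 hi₁).measurable
    apply Measurable.aestronglyMeasurable
    fun_prop
  -- One majorant serves all frequencies: the summand `φ` suffices below `ε` and the summands `ψ₀`,
  -- `ψ₁` above it, so no norm has to be split over two regions.
  have hpt : expansionError σ σ₁ σ₂ s k u₀ u₁ u t ≤
      eLpNorm ((C₁ * N) • φ + (e • ψ₀ + e • ψ₁)) 2 volume := by
    refine eLpNorm_mono_ae ?_
    filter_upwards [ae_solvesOde hn0 hsol ht0.le] with ξ hξ
    obtain ⟨hξ0, v, w, hode, hv0, hw0, hvt⟩ := hξ
    rw [norm_error, hvt, ← hv0, ← hw0]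
    have p1 : 0 ≤ φ ξ := by positivity
    have p2 : 0 ≤ ψ₀ ξ := by positivity
    have p3 : 0 ≤ ψ₁ ξ := by positivity
    simp only [Pi.add_apply, Pi.smul_apply, smul_eq_mul]
    rw [Real.norm_of_nonneg (by positivity)]
    rcases le_total ‖ξ‖ ε with hle | hle
    · refine (h₁ ‖ξ‖ hξ0 hle v w hode t ht0.le).trans ?_
      have q : ‖v 0‖ + ‖w 0‖ ≤ N := by
        rw [hv0, hw0]
        exact add_le_add (norm_hatL1_le _ _) (norm_hatL1_le _ _)
      have q1 : C₁ * (‖v 0‖ + ‖w 0‖) * φ ξ ≤ C₁ * N * φ ξ := by gcongr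
      exact q1.trans (le_add_of_nonneg_right (by positivity))
    · refine (h₂ ‖ξ‖ hle v w hode t ht).trans ?_
      rw [hv0, hw0, mul_add]
      exact le_add_of_nonneg_left (by positivity)
  have hψ₀n : eLpNorm ψ₀ 2 volume = normH s u₀ := by
    refine eLpNorm_congr_norm_ae (Eventually.of_forall fun ξ => ?_)
    rw [hψ₀, norm_mul, norm_mul, norm_norm, Complex.norm_real]
  have hψ₁n : eLpNorm ψ₁ 2 volume = normH (max (s - 2 * σ₂) 0) u₁ := by
    refine eLpNorm_congr_norm_ae (Eventually.of_forall fun ξ => ?_)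
    rw [hψ₁, norm_mul, norm_mul, norm_norm, Complex.norm_real]
  have hts : t ^ ρ ≤ 2 ^ (-ρ) * (1 + t) ^ ρ := by
    have q := Real.rpow_le_rpow_of_nonpos (show 0 < (1 + t) / 2 by linarith)
      (show (1 + t) / 2 ≤ t by linarith) hρ.le
    rw [Real.div_rpow (by linarith) zero_le_two] at q
    rw [Real.rpow_neg zero_le_two, ← div_eq_inv_mul]
    exact q
  have hpos : 0 < (1 + t) ^ ρ := Real.rpow_pos_of_pos (by linarith) _
  set D := (C₁ * (C₃ * 2 ^ (-ρ)) + C₂ * C₄) * (1 + t) ^ ρ with hD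
  have b1 : eLpNorm ((C₁ * N) • φ) 2 volume ≤
      ENNReal.ofReal D * (eLpNorm u₀ 1 volume + eLpNorm u₁ 1 volume) := by
    rw [eLpNorm_const_smul, Real.enorm_of_nonneg (by positivity), mul_comm C₁ N,
      ENNReal.ofReal_mul hN0, ← ofReal_integral_norm hi₀, ← ofReal_integral_norm hi₁,
      ← ENNReal.ofReal_add (integral_nonneg fun _ => norm_nonneg _)
        (integral_nonneg fun _ => norm_nonneg _), ← hN, mul_assoc, mul_comm (ENNReal.ofReal N)]
    gcongr
    refine (mul_le_mul_right (h₃ t ht0) _).trans ?_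
    rw [← ENNReal.ofReal_mul hC₁.le]
    apply ENNReal.ofReal_le_ofReal
    have q : C₁ * (C₃ * t ^ ρ) ≤ C₁ * (C₃ * (2 ^ (-ρ) * (1 + t) ^ ρ)) := by gcongr
    have q' : 0 ≤ C₂ * C₄ * (1 + t) ^ ρ := by positivity
    rw [hD, add_mul]
    linarith
  have heD : e ≤ D := by
    have q : e ≤ C₂ * (C₄ * (1 + t) ^ ρ) := by
      rw [he]
      gcongr
      exact h₄ t ht0.le
    have q' : 0 ≤ C₁ * (C₃ * 2 ^ (-ρ)) * (1 + t) ^ ρ := by positivity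
    rw [hD, add_mul]
    linarith
  have b2 : eLpNorm (e • ψ₀) 2 volume ≤ ENNReal.ofReal D * normH s u₀ := by
    rw [eLpNorm_const_smul, Real.enorm_of_nonneg he0.le, hψ₀n]
    gcongr
  have b3 : eLpNorm (e • ψ₁) 2 volume ≤
      ENNReal.ofReal D * normH (max (s - 2 * σ₂) 0) u₁ := by
    rw [eLpNorm_const_smul, Real.enorm_of_nonneg he0.le, hψ₁n]
    gcongr
  calc expansionError σ σ₁ σ₂ s k u₀ u₁ u t
      ≤ eLpNorm ((C₁ * N) • φ) 2 volume +
        (eLpNorm (e • ψ₀) 2 volume + eLpNorm (e • ψ₁) 2 volume) :=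
        hpt.trans ((eLpNorm_add_le hm (hm₀.add hm₁) one_le_two).trans
          (add_le_add_right (eLpNorm_add_le hm₀ hm₁ one_le_two) _))
    _ ≤ ENNReal.ofReal D * (eLpNorm u₀ 1 volume + eLpNorm u₁ 1 volume) +
        (ENNReal.ofReal D * normH s u₀ +
          ENNReal.ofReal D * normH (max (s - 2 * σ₂) 0) u₁) :=
        add_le_add b1 (add_le_add b2 b3)
    _ = ENNReal.ofReal D * normData σ₂ s u₀ u₁ := by
        rw [normData]
        ring

/-! ### The lower bound -/

/-- The three rays treated here and below are the limiting directions of `(r^{2(σ₂-σ₁)},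
r^{2(σ-2σ₁)})` as `r → 0`, according to which exponent attains the minimum `δ`. -/
theorem eventually_invDisc_fst :
    ∀ᶠ z in 𝓝 (0 : ℝ), invDisc (z * 1) (z * 0) = (1 - (-1) * z) ^ (-1 : ℝ) := by
  refine Eventually.of_forall fun z => ?_
  rw [invDisc, rootDisc, Real.rpow_neg_one]
  simp

theorem eventually_invDisc_snd :
    ∀ᶠ z in 𝓝 (0 : ℝ), invDisc (z * 0) (z * 1) = (1 - 4 * z) ^ (-(1 / 2) : ℝ) := by
  filter_upwards [ge_mem_nhds (show (0 : ℝ) < 1 / 4 by norm_num)] with z hz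
  rw [invDisc, rootDisc, Real.rpow_neg (by linarith), ← Real.sqrt_eq_rpow]
  simp

/-- On the diagonal the discriminant is a perfect square, so the root disappears. -/
theorem eventually_invDisc_diag :
    ∀ᶠ z in 𝓝 (0 : ℝ), invDisc (z * 1) (z * 1) = (1 - 1 * z) ^ (-1 : ℝ) := by
  filter_upwards [lt_mem_nhds (show (-1 : ℝ) < 0 by norm_num),
    gt_mem_nhds (show (0 : ℝ) < 1 by norm_num)] with z hz1 hz2
  have h1 : 0 < 1 + z := by linarith
  have h2 : 0 < 1 - z := by linarith
  have h3 : 1 - 4 * z * (1 + z)⁻¹ ^ 2 = ((1 - z) / (1 + z)) ^ 2 := by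
    field_simp
    ring
  rw [invDisc, rootDisc, Real.rpow_neg_one, mul_one, one_mul, h3, Real.sqrt_sq (by positivity)]
  field_simp

theorem tendsto_rpow_div_of_le {a b : ℝ} (h : b ≤ a) :
    Tendsto (fun r : ℝ => r ^ a / r ^ b) (𝓝[>] 0) (𝓝 (if a = b then 1 else 0)) := by
  have h1 : (fun r : ℝ => r ^ (a - b)) =ᶠ[𝓝[>] 0] fun r => r ^ a / r ^ b := by
    filter_upwards [self_mem_nhdsWithin] with r hr
    exact Real.rpow_sub hr a b
  refine Tendsto.congr' h1 ?_
  split_ifs with hab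
  · simp [hab]
  · have h2 : 0 < a - b := sub_pos.2 (lt_of_le_of_ne h (Ne.symm hab))
    have h3 := (Real.continuousAt_rpow_const 0 (a - b) (Or.inr h2.le)).tendsto
    rw [Real.zero_rpow h2.ne'] at h3
    exact h3.mono_left nhdsWithin_le_nhds

theorem tendsto_rpow_nhdsGT_zero {a : ℝ} (ha : 0 < a) :
    Tendsto (fun r : ℝ => r ^ a) (𝓝[>] 0) (𝓝 0) := by
  have h3 := (Real.continuousAt_rpow_const 0 a (Or.inr ha.le)).tendsto
  rw [Real.zero_rpow ha.ne'] at h3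
  exact h3.mono_left nhdsWithin_le_nhds

section LowerBound

variable {σ σ₁ σ₂ s : ℝ}

/-- The Taylor remainder of the profile at time `0` has exactly the expected size. -/
theorem exists_le_abs_invDisc_sub_taylorSum (hσ₁σ : σ₁ < σ / 2) (hσσ₂ : σ / 2 < σ₂)
    {η : ℝ} (hη : IsGoodRadius η) (k : ℕ) :
    ∃ c > 0, ∀ᶠ r in 𝓝[>] (0 : ℝ), c * (r ^ (2 * min (σ₂ - σ₁) (σ - 2 * σ₁))) ^ k ≤
      |invDisc (r ^ (2 * (σ₂ - σ₁))) (r ^ (2 * (σ - 2 * σ₁))) -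
        taylorSum (fun a b => invDisc (r ^ (2 * (σ₂ - σ₁)) * a)
          (r ^ (2 * (σ - 2 * σ₁)) * b)) k| := by
  set δ := min (σ₂ - σ₁) (σ - 2 * σ₁) with hδ
  have hδ0 : 0 < δ := lt_min (by linarith) (by linarith)
  -- Dividing both variables by `z = r^{2δ}` gives a point that converges to `(u, v)`, and `z → 0`:
  -- the setting of `exists_le_abs_sub_taylorSum`.
  have key : ∀ u v κ α : ℝ, κ ≠ 0 → 0 < α →
      (∀ᶠ z in 𝓝 (0 : ℝ), invDisc (z * u) (z * v) = (1 - κ * z) ^ (-α)) →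
      Tendsto (fun r : ℝ => r ^ (2 * (σ₂ - σ₁)) / r ^ (2 * δ)) (𝓝[>] 0) (𝓝 u) →
      Tendsto (fun r : ℝ => r ^ (2 * (σ - 2 * σ₁)) / r ^ (2 * δ)) (𝓝[>] 0) (𝓝 v) →
      ∃ c > 0, ∀ᶠ r in 𝓝[>] (0 : ℝ), c * (r ^ (2 * δ)) ^ k ≤
      |invDisc (r ^ (2 * (σ₂ - σ₁))) (r ^ (2 * (σ - 2 * σ₁))) -
        taylorSum (fun a b => invDisc (r ^ (2 * (σ₂ - σ₁)) * a)
          (r ^ (2 * (σ - 2 * σ₁)) * b)) k| := by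
    intro u v κ α hκ hα hF hu hv
    obtain ⟨c, hc, h⟩ := hη.2.2.1.exists_le_abs_sub_taylorSum hη.1 hκ hα hF k
    have ht : Tendsto (fun r : ℝ => r ^ (2 * δ)) (𝓝[>] 0) (𝓝[>] 0) := by
      refine tendsto_nhdsWithin_iff.2 ⟨tendsto_rpow_nhdsGT_zero (by positivity), ?_⟩
      filter_upwards [self_mem_nhdsWithin] with r hr
      exact Real.rpow_pos_of_pos hr _
    refine ⟨c, hc, ?_⟩
    filter_upwards [(ht.prodMk (hu.prodMk_nhds hv)).eventually h, self_mem_nhdsWithin]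
      with r hr hr0
    have hz : r ^ (2 * δ) ≠ 0 := (Real.rpow_pos_of_pos hr0 _).ne'
    simpa only [mul_div_cancel₀ _ hz] using hr
  have tp := tendsto_rpow_div_of_le (a := 2 * (σ₂ - σ₁)) (b := 2 * δ)
    (by linarith [min_le_left (σ₂ - σ₁) (σ - 2 * σ₁)])
  have tq := tendsto_rpow_div_of_le (a := 2 * (σ - 2 * σ₁)) (b := 2 * δ)
    (by linarith [min_le_right (σ₂ - σ₁) (σ - 2 * σ₁)])
  rcases lt_trichotomy (σ₂ - σ₁) (σ - 2 * σ₁) with hlt | heq | hgt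
  · have hd : δ = σ₂ - σ₁ := min_eq_left hlt.le
    rw [if_pos (by rw [hd])] at tp
    rw [if_neg (by rw [hd]; intro h; linarith)] at tq
    exact key 1 0 (-1) 1 (by norm_num) one_pos eventually_invDisc_fst tp tq
  · have hd : δ = σ₂ - σ₁ := min_eq_left heq.le
    rw [if_pos (by rw [hd])] at tp
    rw [if_pos (by rw [hd, heq])] at tq
    exact key 1 1 1 1 one_ne_zero one_pos eventually_invDisc_diag tp tq
  · have hd : δ = σ - 2 * σ₁ := min_eq_right hgt.le
    rw [if_neg (by rw [hd]; intro h; linarith)] at tp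
    rw [if_pos (by rw [hd])] at tq
    exact key 0 1 4 (1 / 2) (by norm_num) (by norm_num) eventually_invDisc_snd tp tq

/-- A lower bound for the error of the expansion in the parabolic zone. -/
theorem exists_parabolicZone_lower (hσ₁ : 0 < σ₁) (hσ₁σ : σ₁ < σ / 2) (hσσ₂ : σ / 2 < σ₂)
    (k : ℕ) :
    ∃ c > 0, ∃ α > 0, ∀ N P ε : ℝ, 0 < P → 0 < ε → ∃ T, 1 ≤ T ∧ ∀ t, T ≤ t → ∀ r,
      α * t ^ (-(2 * (σ - σ₁))⁻¹) ≤ r → r ≤ 2 * α * t ^ (-(2 * (σ - σ₁))⁻¹) →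
      r < ε ∧ ∀ v w, SolvesOde σ σ₁ σ₂ r v w → ‖v 0‖ ≤ N → P / 2 ≤ ‖w 0‖ →
        c * P * r ^ lowExponent σ σ₁ σ₂ s k ≤
          r ^ s * ‖v t - (A0 σ σ₁ σ₂ k t r : ℂ) * v 0 - (A1 σ σ₁ σ₂ k t r : ℂ) * w 0‖ := by
  obtain ⟨η, hη⟩ : ∃ η, IsGoodRadius η := exists_hasDoubleSeries
  have hη0 := hη.1
  obtain ⟨c₀, hc₀, hlow⟩ := exists_le_abs_invDisc_sub_taylorSum hσ₁σ hσσ₂ hη k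
  set δ := min (σ₂ - σ₁) (σ - 2 * σ₁) with hδ
  have hδ0 : 0 < δ := lt_min (by linarith) (by linarith)
  set γ := 2 * (σ - σ₁) with hγ
  have hγ0 : 0 < γ := by linarith
  set C₀ := (η⁻¹) ^ k with hC₀
  have hC₀0 : 0 < C₀ := by positivity
  -- Solves `2 C₀ (exp (2 x₀) - 1) = c₀ / 4`, so for `r^{2(σ-σ₁)} t ≤ x₀` the slow exponential costs
  -- at most a quarter of the main term.
  set x₀ := Real.log (1 + c₀ / (8 * C₀)) / 2 with hx₀
  have hx₀0 : 0 < x₀ := by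
    have : 0 < Real.log (1 + c₀ / (8 * C₀)) := Real.log_pos (by
      have : 0 < c₀ / (8 * C₀) := by positivity
      linarith)
    positivity
  have hexp : C₀ * (2 * (Real.exp (2 * x₀) - 1)) = c₀ / 4 := by
    rw [hx₀, mul_div_cancel₀ _ (two_ne_zero), Real.exp_log (by positivity)]
    field_simp
    ring
  -- At the outer radius `r = 2 α t^{-1/γ}` one has `r ^ γ t = x₀`.
  set α := x₀ ^ γ⁻¹ / 2 with hα
  have hα0 : 0 < α := by positivity
  -- Two quarters of `c₀` go to the exponentials; the remaining `c₀ / 2` times `P / 2` loses `c₀ P /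
  -- 8` to the `v 0` term, which leaves `c₀ P / 8`. Both `c₀` and `α` are fixed before the data, and
  -- only `T` depends on them.
  refine ⟨c₀ / 8, by positivity, α, hα0, ?_⟩
  intro N P ε hP hε
  have hev : ∀ᶠ r in 𝓝[>] (0 : ℝ), r < ε ∧ r ≤ 1 ∧ r ^ (2 * δ) ≤ η ∧
      r ^ (2 * σ₁) * (4 * C₀ * N) ≤ c₀ * P / 8 ∧
      c₀ * (r ^ (2 * δ)) ^ k ≤ |invDisc (r ^ (2 * (σ₂ - σ₁))) (r ^ (2 * (σ - 2 * σ₁))) -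
        taylorSum (fun a b => invDisc (r ^ (2 * (σ₂ - σ₁)) * a)
          (r ^ (2 * (σ - 2 * σ₁)) * b)) k| := by
    refine .and ?_ (.and ?_ (.and ?_ (.and ?_ hlow)))
    · exact mem_of_superset (Ioo_mem_nhdsGT hε) fun r hr => hr.2
    · exact mem_of_superset (Ioo_mem_nhdsGT one_pos) fun r hr => hr.2.le
    · exact (tendsto_rpow_nhdsGT_zero (by positivity)).eventually (ge_mem_nhds hη0)
    · have h1 := (tendsto_rpow_nhdsGT_zero (show 0 < 2 * σ₁ by positivity)).mul_const
        (4 * C₀ * N)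
      rw [zero_mul] at h1
      exact h1.eventually (ge_mem_nhds (by positivity))
  obtain ⟨R, hR, hsub⟩ := mem_nhdsGT_iff_exists_Ioo_subset.1 hev
  have hev₂ : ∀ᶠ t in atTop, 2 * α * t ^ (-γ⁻¹) < R ∧
      C₀ * (2 * Real.exp (-(α ^ (2 * σ₁) * t ^ (1 - 2 * σ₁ * γ⁻¹)) / 2)) ≤ c₀ / 4 := by
    refine .and ?_ ?_
    · have h1 := (tendsto_rpow_neg_atTop (show 0 < γ⁻¹ by positivity)).const_mul (2 * α)
      rw [mul_zero] at h1
      exact h1.eventually (gt_mem_nhds hR)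
    · have h0 : 0 < 1 - 2 * σ₁ * γ⁻¹ := by
        rw [sub_pos, ← div_eq_mul_inv, div_lt_one hγ0]
        linarith
      have h1 := ((tendsto_rpow_atTop h0).const_mul_atTop
        (show 0 < α ^ (2 * σ₁) / 2 by positivity))
      have h2 := ((Real.tendsto_exp_neg_atTop_nhds_zero.comp h1).const_mul 2).const_mul C₀
      rw [mul_zero, mul_zero] at h2
      have h3 := h2.eventually (ge_mem_nhds (show 0 < c₀ / 4 by positivity))
      filter_upwards [h3] with t ht
      rw [neg_div, mul_div_right_comm]
      exact ht
  obtain ⟨T, hT⟩ := (hev₂.and (eventually_ge_atTop (1 : ℝ))).exists_forall_of_atTop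
  refine ⟨max T 1, le_max_right _ _, ?_⟩
  intro t ht r hr1 hr2
  obtain ⟨⟨ht1, ht2⟩, ht3⟩ := hT t ((le_max_left _ _).trans ht)
  have ht0 : 0 < t := by linarith
  have hτ0 : 0 < t ^ (-γ⁻¹) := Real.rpow_pos_of_pos ht0 _
  have hr0 : 0 < r := lt_of_lt_of_le (by positivity) hr1
  obtain ⟨hrε, hrone, hrδ, hrN, hrlow⟩ := hsub ⟨hr0, hr2.trans_lt ht1⟩
  refine ⟨hrε, ?_⟩
  intro v w hode hv hw
  obtain ⟨hp, hq⟩ := rpow_le_rpow_min (σ := σ) (σ₁ := σ₁) (σ₂ := σ₂) hr0 hrone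
  rw [← hδ] at hp hq
  have hp0 : 0 < r ^ (2 * (σ₂ - σ₁)) := Real.rpow_pos_of_pos hr0 _
  have hq0 : 0 < r ^ (2 * (σ - 2 * σ₁)) := Real.rpow_pos_of_pos hr0 _
  have hP0 : 0 < r ^ (2 * σ₁) := Real.rpow_pos_of_pos hr0 _
  have hZ0 : 0 < (r ^ (2 * δ)) ^ k := by positivity
  have hθ : r ^ (2 * δ) / η * η = r ^ (2 * δ) := div_mul_cancel₀ _ hη0.ne'
  have hθ1 : r ^ (2 * δ) / η ≤ 1 := (div_le_one hη0).2 hrδ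
  have hθk : (r ^ (2 * δ) / η) ^ k = C₀ * (r ^ (2 * δ)) ^ k := by
    rw [hC₀, div_eq_mul_inv, mul_pow, mul_comm]
  have hD := (disc_pos (A := r ^ (2 * (σ₂ - σ₁))) (B := r ^ (2 * (σ - 2 * σ₁)))
    (by rw [abs_of_pos hp0]; linarith [hη.2.1]) (by rw [abs_of_pos hq0]; linarith [hη.2.1])).2
  have b0 := abs_E0_sub_A0_le hη hr0 ht0.le (by positivity) hθ1 (hθ ▸ hp) (hθ ▸ hq) k
  have b1 := le_abs_E1_sub_A1 hη hr0 ht0.le (by positivity) hθ1 (hθ ▸ hp) (hθ ▸ hq) k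
  rw [← (rpow_two_mul_sub (σ := σ) (σ₁ := σ₁) (σ₂ := σ₂) hr0).2.2, ← hγ, hθk] at b0 b1
  have hx : r ^ γ * t ≤ x₀ := by
    have q := Real.rpow_le_rpow hr0.le hr2 hγ0.le
    rw [hα, mul_div_cancel₀ _ (two_ne_zero), Real.mul_rpow (by positivity) hτ0.le,
      ← Real.rpow_mul hx₀0.le, ← Real.rpow_mul ht0.le, inv_mul_cancel₀ hγ0.ne', neg_mul,
      inv_mul_cancel₀ hγ0.ne', Real.rpow_one, Real.rpow_neg_one] at q
    calc r ^ γ * t ≤ x₀ * t⁻¹ * t := by gcongr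
      _ = x₀ := by field_simp
  have hy : α ^ (2 * σ₁) * t ^ (1 - 2 * σ₁ * γ⁻¹) ≤ r ^ (2 * σ₁) * t := by
    have q := Real.rpow_le_rpow (by positivity) hr1 (show 0 ≤ 2 * σ₁ by positivity)
    rw [Real.mul_rpow hα0.le hτ0.le, ← Real.rpow_mul ht0.le] at q
    calc α ^ (2 * σ₁) * t ^ (1 - 2 * σ₁ * γ⁻¹)
        = α ^ (2 * σ₁) * t ^ (-γ⁻¹ * (2 * σ₁)) * t := by
          rw [mul_assoc (α ^ (2 * σ₁)), ← Real.rpow_add_one ht0.ne']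
          congr 2
          ring
      _ ≤ _ := by gcongr
  have s1 : C₀ * (2 * (Real.exp (2 * (r ^ γ * t)) - 1)) ≤ c₀ / 4 := by
    rw [← hexp]
    gcongr
  have s2 : C₀ * (2 * Real.exp (-(r ^ (2 * σ₁) * t) / 2)) ≤ c₀ / 4 := by
    refine le_trans ?_ ht2
    gcongr
  have b1' : (r ^ (2 * σ₁))⁻¹ * ((r ^ (2 * δ)) ^ k * (c₀ / 2)) ≤
      |E1 σ σ₁ σ₂ t r - A1 σ σ₁ σ₂ k t r| := by
    refine le_trans ?_ b1
    gcongr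
    have q1 := mul_le_mul_of_nonneg_left s1 hZ0.le
    have q2 := mul_le_mul_of_nonneg_left s2 hZ0.le
    linarith
  have b0' : |E0 σ σ₁ σ₂ t r - A0 σ σ₁ σ₂ k t r| ≤ (r ^ (2 * δ)) ^ k * (4 * C₀) := by
    refine b0.trans ?_
    have q1 : Real.exp (-(r ^ γ * t) / 2) ≤ 1 := Real.exp_le_one_iff.2 (by
      have : 0 < r ^ γ * t := by positivity
      linarith)
    have q2 : Real.exp (-(r ^ (2 * σ₁) * t) / 2) ≤ 1 := Real.exp_le_one_iff.2 (by
      have : 0 < r ^ (2 * σ₁) * t := by positivity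
      linarith)
    have q3 : 0 < C₀ * (r ^ (2 * δ)) ^ k := by positivity
    have q4 := mul_le_mul_of_nonneg_left (add_le_add q1 q2) q3.le
    linarith
  rw [hode.eq_explicit hr0 hD ht0.le]
  have e1 : (E0 σ σ₁ σ₂ t r : ℂ) * v 0 + (E1 σ σ₁ σ₂ t r : ℂ) * w 0 -
      (A0 σ σ₁ σ₂ k t r : ℂ) * v 0 - (A1 σ σ₁ σ₂ k t r : ℂ) * w 0 =
      ((E1 σ σ₁ σ₂ t r - A1 σ σ₁ σ₂ k t r : ℝ) : ℂ) * w 0 -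
      (-((E0 σ σ₁ σ₂ t r - A0 σ σ₁ σ₂ k t r : ℝ) : ℂ) * v 0) := by
    push_cast
    ring
  rw [e1]
  have e2 := norm_sub_norm_le (((E1 σ σ₁ σ₂ t r - A1 σ σ₁ σ₂ k t r : ℝ) : ℂ) * w 0)
    (-((E0 σ σ₁ σ₂ t r - A0 σ σ₁ σ₂ k t r : ℝ) : ℂ) * v 0)
  rw [norm_mul, norm_mul, norm_neg, Complex.norm_real, Complex.norm_real, Real.norm_eq_abs,
    Real.norm_eq_abs] at e2
  have e3 : (r ^ (2 * σ₁))⁻¹ * ((r ^ (2 * δ)) ^ k * (c₀ / 2)) * (P / 2) ≤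
      |E1 σ σ₁ σ₂ t r - A1 σ σ₁ σ₂ k t r| * ‖w 0‖ :=
    mul_le_mul b1' hw (by positivity) (abs_nonneg _)
  have e4 : |E0 σ σ₁ σ₂ t r - A0 σ σ₁ σ₂ k t r| * ‖v 0‖ ≤
      (r ^ (2 * σ₁))⁻¹ * (r ^ (2 * δ)) ^ k * (c₀ * P / 8) := by
    calc |E0 σ σ₁ σ₂ t r - A0 σ σ₁ σ₂ k t r| * ‖v 0‖
        ≤ (r ^ (2 * δ)) ^ k * (4 * C₀) * N :=
          mul_le_mul b0' hv (norm_nonneg _) (by positivity)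
      _ = (r ^ (2 * σ₁))⁻¹ * (r ^ (2 * δ)) ^ k * (r ^ (2 * σ₁) * (4 * C₀ * N)) := by
          field_simp
      _ ≤ _ := by gcongr
  calc c₀ / 8 * P * r ^ lowExponent σ σ₁ σ₂ s k
      = r ^ s * ((r ^ (2 * σ₁))⁻¹ * (r ^ (2 * δ)) ^ k * (c₀ * P / 8)) := by
        rw [rpow_lowExponent hr0, ← hδ]
        ring
    _ ≤ _ := by
        gcongr
        linarith

/-- The ball of radius `2ρ` has `2 ^ n ≥ 2` times the volume of the ball of radius `ρ`. -/
theorem le_volume_annulus {n : ℕ} (hn : 0 < n) {ρ : ℝ} (hρ : 0 ≤ ρ) :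
    ENNReal.ofReal (ρ ^ n) * volume (Metric.ball (0 : Rn n) 1) ≤
      volume (Metric.ball (0 : Rn n) (2 * ρ) \ Metric.ball 0 ρ) := by
  have : Nonempty (Fin n) := ⟨⟨0, hn⟩⟩
  have h1 := Measure.addHaar_ball (volume : Measure (Rn n)) 0 hρ
  have h2 := Measure.addHaar_ball (volume : Measure (Rn n)) 0 (show 0 ≤ 2 * ρ by positivity)
  rw [finrank_euclideanSpace_fin] at h1 h2
  rw [← h1]
  have hfin : volume (Metric.ball (0 : Rn n) ρ) ≠ ⊤ := measure_ball_lt_top.ne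
  refine le_trans ?_ le_measure_sdiff
  refine ENNReal.le_sub_of_add_le_right hfin ?_
  rw [h1, h2, mul_pow, ENNReal.ofReal_mul (by positivity), ← two_mul, mul_assoc]
  gcongr
  rw [← ENNReal.ofReal_ofNat]
  apply ENNReal.ofReal_le_ofReal
  exact le_self_pow₀ one_le_two hn.ne'

theorem expansionError_lower (n k : ℕ)
    (hσ₁ : 0 < σ₁) (hσ₁σ : σ₁ < σ / 2) (hσσ₂ : σ / 2 < σ₂)
    (hn : 4 * σ₁ < (n : ℝ)) (hs : 0 ≤ s) :
    ∃ c : ℝ, 0 < c ∧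
      ∀ (u₀ u₁ : Rn n → ℂ) (u : ℝ → Lp ℂ 2 (volume : Measure (Rn n))),
        MemData σ₂ s u₀ u₁ → IsSolution σ σ₁ σ₂ u₀ u₁ u → (∫ x, u₁ x) ≠ 0 →
        ∃ T : ℝ, 1 ≤ T ∧ ∀ t : ℝ, T ≤ t →
          ENNReal.ofReal (c * ‖∫ x, u₁ x‖ * (1 + t) ^ rate n σ σ₁ σ₂ s k) ≤
            expansionError σ σ₁ σ₂ s k u₀ u₁ u t := by
  have hn0 : 0 < n := by
    have : (0 : ℝ) < n := by linarith
    exact_mod_cast this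
  have : Nonempty (Fin n) := ⟨⟨0, hn0⟩⟩
  obtain ⟨c, hc, α, hα, h⟩ := exists_parabolicZone_lower (s := s) hσ₁ hσ₁σ hσσ₂ k
  have hρ := rate_neg (k := k) hσ₁ hσ₁σ hσσ₂ hn hs
  set β := lowExponent σ σ₁ σ₂ s k with hβ
  -- The exponent `β` may have either sign, so the least value of `r ^ β` on the annulus may occur
  -- at either radius.
  set m := min (α ^ β) ((2 * α) ^ β) with hm
  have hm0 : 0 < m := by positivity
  set V := (volume (Metric.ball (0 : Rn n) 1)).toReal with hV
  have hV0 : 0 < V := ENNReal.toReal_pos (Metric.measure_ball_pos _ _ one_pos).ne'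
    measure_ball_lt_top.ne
  refine ⟨c * m * (α ^ n * V) ^ (1 / 2 : ℝ), by positivity, ?_⟩
  intro u₀ u₁ u hdata hsol hP
  have hP0 : 0 < ‖∫ x, u₁ x‖ := norm_pos_iff.2 hP
  have hcont := continuous_hatL1 hdata.2.1
  have hnear : ∀ᶠ ξ in 𝓝 (0 : Rn n), ‖∫ x, u₁ x‖ / 2 ≤ ‖hatL1 u₁ ξ‖ := by
    refine (hcont.norm.tendsto 0).eventually (le_mem_nhds ?_)
    rw [hatL1_zero]
    linarith
  obtain ⟨ε, hε, hball⟩ := Metric.eventually_nhds_iff.1 hnear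
  obtain ⟨T, hT1, hT⟩ := h (∫ x, ‖u₀ x‖) ‖∫ x, u₁ x‖ ε hP0 hε
  refine ⟨T, hT1, ?_⟩
  intro t ht
  have ht0 : 0 < t := by linarith
  set τ := t ^ (-(2 * (σ - σ₁))⁻¹) with hτ
  have hτ0 : 0 < τ := Real.rpow_pos_of_pos ht0 _
  set S := Metric.ball (0 : Rn n) (2 * (α * τ)) \ Metric.ball 0 (α * τ) with hS
  have hSm : MeasurableSet S := measurableSet_ball.diff measurableSet_ball
  set M := c * ‖∫ x, u₁ x‖ * (m * τ ^ β) with hM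
  have hM0 : 0 < M := by positivity
  have hlow : eLpNorm (S.indicator fun _ => M) 2 volume ≤
      expansionError σ σ₁ σ₂ s k u₀ u₁ u t := by
    refine eLpNorm_mono_ae ?_
    filter_upwards [ae_solvesOde hn0 hsol ht0.le] with ξ hξ
    by_cases hξS : ξ ∈ S
    · obtain ⟨hξ0, v, w, hode, hv0, hw0, hvt⟩ := hξ
      rw [norm_error, hvt, ← hv0, ← hw0, Set.indicator_of_mem hξS, Real.norm_of_nonneg hM0.le]
      rw [hS, Set.mem_sdiff, mem_ball_zero_iff, mem_ball_zero_iff, not_lt] at hξS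
      obtain ⟨hξε, hb⟩ := hT t ht ‖ξ‖ hξS.2 (by linarith [hξS.1])
      refine le_trans ?_ (hb v w hode (by rw [hv0]; exact norm_hatL1_le _ _)
        (by rw [hw0]; exact hball (by simpa using hξε)))
      rw [hM]
      gcongr
      rcases le_total 0 β with h0 | h0
      · calc m * τ ^ β ≤ α ^ β * τ ^ β := by gcongr; exact min_le_left _ _
          _ = (α * τ) ^ β := (Real.mul_rpow hα.le hτ0.le).symm
          _ ≤ ‖ξ‖ ^ β := Real.rpow_le_rpow (by positivity) hξS.2 h0
      · calc m * τ ^ β ≤ (2 * α) ^ β * τ ^ β := by gcongr; exact min_le_right _ _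
          _ = (2 * α * τ) ^ β := (Real.mul_rpow (by positivity) hτ0.le).symm
          _ ≤ ‖ξ‖ ^ β := Real.rpow_le_rpow_of_nonpos hξ0 (by linarith [hξS.1]) h0
    · rw [Set.indicator_of_notMem hξS, norm_zero]
      exact norm_nonneg _
  refine le_trans ?_ hlow
  rw [eLpNorm_indicator_const hSm two_ne_zero ENNReal.ofNat_ne_top, Real.enorm_of_nonneg hM0.le]
  have hvol := le_volume_annulus hn0 (show 0 ≤ α * τ by positivity)
  rw [← ENNReal.ofReal_toReal (a := volume (Metric.ball (0 : Rn n) 1)) measure_ball_lt_top.ne,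
    ← hV, ← ENNReal.ofReal_mul (by positivity)] at hvol
  have hvol' := ENNReal.rpow_le_rpow hvol (show (0 : ℝ) ≤ 1 / 2 by norm_num)
  rw [ENNReal.ofReal_rpow_of_nonneg (by positivity) (by norm_num)] at hvol'
  rw [ENNReal.toReal_ofNat]
  refine le_trans ?_ (mul_le_mul_right hvol' _)
  rw [← ENNReal.ofReal_mul hM0.le]
  apply ENNReal.ofReal_le_ofReal
  -- The rate combines the pointwise size `τ ^ β` with the square root of the volume, of order `τ ^
  -- n`, of the annulus.
  have hrate : τ ^ β * (τ ^ n) ^ (1 / 2 : ℝ) = t ^ rate n σ σ₁ σ₂ s k := by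
    rw [← Real.rpow_natCast τ n, ← Real.rpow_mul hτ0.le, ← Real.rpow_add hτ0, hτ,
      ← Real.rpow_mul ht0.le, ← rate_eq (by linarith), ← hβ]
    congr 1
    have : σ - σ₁ ≠ 0 := by linarith
    field_simp
  have ht1 : (1 + t) ^ rate n σ σ₁ σ₂ s k ≤ t ^ rate n σ σ₁ σ₂ s k :=
    Real.rpow_le_rpow_of_nonpos ht0 (by linarith) hρ.le
  calc c * m * (α ^ n * V) ^ (1 / 2 : ℝ) * ‖∫ x, u₁ x‖ * (1 + t) ^ rate n σ σ₁ σ₂ s k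
      ≤ c * m * (α ^ n * V) ^ (1 / 2 : ℝ) * ‖∫ x, u₁ x‖ *
        (τ ^ β * (τ ^ n) ^ (1 / 2 : ℝ)) := by
        rw [hrate]
        gcongr
    _ = M * ((α * τ) ^ n * V) ^ (1 / 2 : ℝ) := by
        rw [hM, mul_pow, mul_right_comm (α ^ n), Real.mul_rpow (x := α ^ n * V) (by positivity)
          (by positivity)]
        ring

end LowerBound

end DoubleDamping

end

theorem theorem1 (n k : ℕ) (σ σ₁ σ₂ s : ℝ)
    (hσ₁ : 0 < σ₁) (hσ₁σ : σ₁ < σ / 2) (hσσ₂ : σ / 2 < σ₂) (hσ₂ : σ₂ ≤ σ)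
    (hn : 4 * σ₁ < (n : ℝ)) (hs : 0 ≤ s) :
    (∃ C : ℝ, 0 < C ∧
      ∀ (u₀ u₁ : DoubleDamping.Rn n → ℂ)
        (u : ℝ → MeasureTheory.Lp ℂ 2
          (MeasureTheory.volume : MeasureTheory.Measure (DoubleDamping.Rn n))),
        DoubleDamping.MemData σ₂ s u₀ u₁ →
        DoubleDamping.IsSolution σ σ₁ σ₂ u₀ u₁ u →
        ∀ t : ℝ, 1 ≤ t →
          DoubleDamping.expansionError σ σ₁ σ₂ s k u₀ u₁ u t ≤
            ENNReal.ofReal (C * (1 + t) ^ DoubleDamping.rate n σ σ₁ σ₂ s k)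
              * DoubleDamping.normData σ₂ s u₀ u₁) ∧
    (∃ c : ℝ, 0 < c ∧
      ∀ (u₀ u₁ : DoubleDamping.Rn n → ℂ)
        (u : ℝ → MeasureTheory.Lp ℂ 2
          (MeasureTheory.volume : MeasureTheory.Measure (DoubleDamping.Rn n))),
        DoubleDamping.MemData σ₂ s u₀ u₁ →
        DoubleDamping.IsSolution σ σ₁ σ₂ u₀ u₁ u →
        (∫ x, u₁ x) ≠ 0 →
        ∃ T : ℝ, 1 ≤ T ∧ ∀ t : ℝ, T ≤ t →
          ENNReal.ofReal (c * ‖∫ x, u₁ x‖ * (1 + t) ^ DoubleDamping.rate n σ σ₁ σ₂ s k) ≤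
            DoubleDamping.expansionError σ σ₁ σ₂ s k u₀ u₁ u t) := by
  exact ⟨DoubleDamping.expansionError_upper n k hσ₁ hσ₁σ hσσ₂ hσ₂ hn hs,
    DoubleDamping.expansionError_lower n k hσ₁ hσ₁σ hσσ₂ hn hs⟩
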